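/- Notation. A hypergraph $H$ on a finite vertex set $V$ with $|V|=n$ is identified with its set of edges, and $\Delta(H)$ is its maximum vertex degree. For integers $r\ge 1$, $t\ge 2$, let $\mathcal J(r,t)$ be the class of $rt^2$-uniform hypergraphs in which any two edges $e,f$ satisfy $t\mid |e\cap f|$ or $|e\cap f|\ge rt(t-1)$. An $s$-star is a hypergraph $E$ with a distinguished $s$-set $S$ (its centre) contained in every edge; its body is $\bigcup_{h\in E}(h\setminus S)$. Stars are semi-disjoint if their centres are distinct and their bodies are pairwise disjoint. A set $W\subseteq V$ is inseparable in $H$ if $W\cap h\in\{\emptyset,W\}$ for all $h\in H$. For natural numbers $t,\ell,a$, an $\ell t$-uniform hypergraph $H$ belongs to $\mathcal F(t,\ell,a)$ if there are partitions (with possibly empty parts) $V=V_T\cup V_S\cup V_R$ and $H=H_T\cup H_S\cup H_R$ such that (i) $V_T$ is a disjoint union of $t$-sets that are inseparable in $H$, and $H_T=\{h\in H: h\subseteq V_T\}$; (ii) $H_S=\{h\in H: |h\cap V_S|=\ell\}$ is the union of a collection of semi-disjoint $\ell(t-1)$-stars with centres in $V_T\cup V_R$ and bodies in $V_S$; (iii)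 every edge of $H$ meeting the body of one of these stars contains the centre of that star; (iv) $|H_R|\le |V_T||V_S|n^{\ell-3}+|V_R|\,a\,n^{\ell-2}$. A thick clique $\widetilde K^{rt^2}_{n,t}$ on $V$ is obtained by choosing $\lfloor n/t\rfloor$ pairwise disjoint $t$-subsets (teams) of $V$ and taking as edges all unions of $rt$ teams. Theorem. For all $r\ge 1$ and $t\ge 2$ there exists $n_0$ such that for every $n\ge n_0$ and every $H\in\mathcal J(r,t)$ with $n$ vertices and $m$ edges the following hold. (1) If $m\ge\binom{\lfloor n/t\rfloor}{rt}+1$, then $H\in\mathcal F\bigl(t,rt,(rt^2)^{r^3t^6}\bigr)$, and for $$\hat n=\min\Bigl\{N\ge 1:\binom{N-1}{rt-1}\ge\frac{rtm}{n}-rt\,n^{rt-2}\Bigr\}$$ one has $$\hat n\ \ge\ \frac{n}{t^{rt/(rt-1)}}-(3rt)^{3rt}\ >\ \frac{2n}{5t}\qquad\text{and}\qquad \frac{m\hat n}{n}-n^{rt-1}>\frac{m}{3t}.$$ Moreover, for every choice of partitions and stars witnessing $H\in\mathcal F\bigl(t,rt,(rt^2)^{r^3t^6}\bigr)$, one of the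 $rt(t-1)$-stars forming $H_S$ has at least $\hat n$ vertices in its body and at least $m\hat n/n-n^{rt-1}$ edges. (2) If $\binom{\lfloor n/t\rfloor}{rt}-\dfrac{n^{rt-1}}{2t^{rt-1}(rt-1)!}\le m\le\binom{\lfloor n/t\rfloor}{rt}$ and $\Delta(H)\le m/(3t)$, then $H$ is a subhypergraph of a thick clique $\widetilde K^{rt^2}_{n,t}$ on its vertex set; in particular, $\Delta(H)\le\binom{\lfloor n/t\rfloor-1}{rt-1}$. -/

import Mathlib

/-! Hypergraphs on a finite vertex set `V` are given by their edge sets `H : Finset (Finset V)`. -/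

namespace StarsCliques

variable {V : Type*} [DecidableEq V]

/-- The class `J(r,t)`: all `rt²`-uniform hypergraphs in which any two edges meet in a set whose
size is divisible by `t` or at least `rt(t-1)`. -/
def InJ (r t : ℕ) (H : Finset (Finset V)) : Prop :=
  (∀ e ∈ H, e.card = r * t ^ 2) ∧
    ∀ e ∈ H, ∀ f ∈ H, t ∣ (e ∩ f).card ∨ r * t * (t - 1) ≤ (e ∩ f).card

/-- The set `E` of edges forms an `s`-star with centre `S`. -/
def IsStar (s : ℕ) (S : Finset V) (E : Finset (Finset V)) : Prop :=
  S.card = s ∧ ∀ e ∈ E, S ⊆ e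

/-- The body of the star with centre `S` and edge set `E`. -/
def body (S : Finset V) (E : Finset (Finset V)) : Finset V :=
  E.biUnion fun e => e \ S

/-- `W` is inseparable in `H`: every edge contains `W` or is disjoint from it. -/
def Inseparable (H : Finset (Finset V)) (W : Finset V) : Prop :=
  ∀ h ∈ H, W ∩ h = ∅ ∨ W ∩ h = W

/-- Partitions `V = V_T ∪ V_S ∪ V_R` and `H = H_T ∪ H_S ∪ H_R` witnessing that the `ℓt`-uniform
hypergraph `H` belongs to the class `F(t,ℓ,a)`. The semi-disjoint stars forming `H_S` are recorded
by their (distinct) centres; `star S` is the edge set of the star with centre `S`. -/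
structure Decomposition [Fintype V] (t l a : ℕ) (H : Finset (Finset V)) where
  VT : Finset V
  VS : Finset V
  VR : Finset V
  disjoint_VT_VS : Disjoint VT VS
  disjoint_VT_VR : Disjoint VT VR
  disjoint_VS_VR : Disjoint VS VR
  union_V : VT ∪ VS ∪ VR = Finset.univ
  HT : Finset (Finset V)
  HS : Finset (Finset V)
  HR : Finset (Finset V)
  disjoint_HT_HS : Disjoint HT HS
  disjoint_HT_HR : Disjoint HT HR
  disjoint_HS_HR : Disjoint HS HR
  union_H : HT ∪ HS ∪ HR = H
  /-- `V_T` is partitioned into inseparable `t`-sets. -/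
  teams : ∃ P : Finset (Finset V),
    (∀ W ∈ P, W.card = t ∧ Inseparable H W) ∧
    (∀ W ∈ P, ∀ W' ∈ P, W ≠ W' → Disjoint W W') ∧
    VT = P.biUnion id
  HT_eq : HT = H.filter fun h => h ⊆ VT
  HS_eq : HS = H.filter fun h => (h ∩ VS).card = l
  centres : Finset (Finset V)
  star : Finset V → Finset (Finset V)
  HS_eq_stars : HS = centres.biUnion star
  isStar : ∀ S ∈ centres, IsStar (l * (t - 1)) S (star S)
  centre_subset : ∀ S ∈ centres, S ⊆ VT ∪ VR
  body_subset : ∀ S ∈ centres, body S (star S) ⊆ VS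
  bodies_disjoint : ∀ S ∈ centres, ∀ S' ∈ centres, S ≠ S' →
    Disjoint (body S (star S)) (body S' (star S'))
  /-- Every edge that meets the body of a star contains its centre. -/
  centre_subset_of_meets_body : ∀ S ∈ centres, ∀ e ∈ H,
    (e ∩ body S (star S)).Nonempty → S ⊆ e
  /-- The exponents `ℓ - 3` and `ℓ - 2` are integers, possibly negative. -/
  card_HR_le : (HR.card : ℝ) ≤
    VT.card * VS.card * (Fintype.card V : ℝ) ^ ((l : ℤ) - 3) +
      VR.card * a * (Fintype.card V : ℝ) ^ ((l : ℤ) - 2)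

/-- The class `F(t,ℓ,a)` of `ℓt`-uniform hypergraphs. -/
def InF [Fintype V] (t l a : ℕ) (H : Finset (Finset V)) : Prop :=
  (∀ e ∈ H, e.card = l * t) ∧ Nonempty (Decomposition t l a H)

/-- `K` is a thick `(k,n,t)`-clique on the `n`-element set `V`: there are `⌊n/t⌋` disjoint `t`-sets
(teams), and the edges of `K` are exactly the unions of `k/t` teams. -/
def IsThickClique [Fintype V] (k t : ℕ) (K : Finset (Finset V)) : Prop :=
  ∃ P : Finset (Finset V), P.card = Fintype.card V / t ∧
    (∀ W ∈ P, W.card = t) ∧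
    (∀ W ∈ P, ∀ W' ∈ P, W ≠ W' → Disjoint W W') ∧
    K = (P.powersetCard (k / t)).image fun Q => Q.biUnion id

/-- The maximum vertex degree of `H`. -/
def maxDegree [Fintype V] (H : Finset (Finset V)) : ℕ :=
  Finset.univ.sup fun v : V => (H.filter fun e => v ∈ e).card

end StarsCliques

/-! Put `l = r * t`, so edges have `l * t` vertices. Call a set a kernel if it is an edge or the
common part of a large sunflower of edges. Petals can be chosen to avoid any bounded set outside the
kernel, so kernels inherit the intersection condition (`IsKernel.card_inter`). Because `t ∣ l`, two
admissible sizes that differ by less than `t` force the larger above `l * (t - 1)`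
(`Admissible.lt_of_add`). Hence a kernel of size `t` is inseparable (a team), and if `S` and `S ∪
{v}` are kernels with `|S| = l * (t - 1)`, then every edge through `v` contains `S` (a star with `v`
in its body).

Let `R` be the set of vertices of neither kind. An edge with a body vertex and a team outside its
centre has few free vertices and is counted directly. From the other leftover edges, the sunflower
lemma deletes `O(|R| n^(l-2))` so that in the surviving family `G` any fewer than `l` vertices of an
edge, one of them in `R`, lie in a strong kernel properly inside that edge. In a suitably chosen
edge around a kernel `K`, all strong kernels meet `K` in strong kernels (`IsKernel.exists_typical`).
So a minimal kernel at a vertex of `R` can be extended to a chain of kernels that gains at least `t`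
vertices per generating vertex. Since it starts with at least `2 * t` vertices, it fills an edge
with fewer than `l` generators, which contradicts the covering property. Thus `G` is empty, and `H`
belongs to the class `F`.

For the extremal statements, suppose every star has at most `|body| * (m / n - n^(l-2))` edges. Then
vertices outside the teams carry less than the average number of edges, which rules out a small
number of teams; near the maximum, each missing team loses more edges than its vertices regain
elsewhere. So there are `⌊n/t⌋` teams and every edge is a union of teams
(`Decomposition.exists_teams`). With more edges than a thick clique this is impossible, so a large
star exists; with small maximum degree no star is large, so `H` lies in a thick clique. -/

namespace StarsCliques

variable {V : Type*} [DecidableEq V]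

/-! ### Sunflowers and their kernels -/

/-- The members of `F` contain `K` and pairwise meet exactly in `K`. -/
def IsSunflower (K : Finset V) (F : Finset (Finset V)) : Prop :=
  (∀ f ∈ F, K ⊆ f) ∧ ∀ f ∈ F, ∀ g ∈ F, f ≠ g → f ∩ g = K

/-- The sunflower lemma of Erdős and Rado. -/
theorem exists_sunflower (p : ℕ) : ∀ (k : ℕ) (F : Finset (Finset V)), (∀ f ∈ F, f.card = k) →
    k.factorial * p ^ k < F.card → ∃ K, ∃ F' ⊆ F, p < F'.card ∧ IsSunflower K F'
  | 0, F, hF, hc => by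
    exfalso
    have : F ⊆ {∅} := fun f hf => by simpa using hF f hf
    have := Finset.card_le_card this
    simp at this hc
    omega
  | k + 1, F, hF, hc => by
    classical
    -- A maximal disjoint subfamily is a sunflower with empty kernel if it is large; otherwise its
    -- union `U` meets every member, and induction applies to the link of a popular vertex of `U`.
    let Q : Finset (Finset V) → Prop := fun D =>
      D ⊆ F ∧ ∀ f ∈ D, ∀ g ∈ D, f ≠ g → f ∩ g = ∅
    obtain ⟨D, hD, hmax⟩ := Finset.exists_max_image (F.powerset.filter Q) Finset.card
      ⟨∅, by simp [Q]⟩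
    have hDQ : Q D := (Finset.mem_filter.mp hD).2
    by_cases hp : p < D.card
    · exact ⟨∅, D, hDQ.1, hp, by simp, hDQ.2⟩
    push Not at hp
    let U := D.biUnion id
    have hU : U.card ≤ p * (k + 1) :=
      (Finset.card_biUnion_le_card_mul D id (k + 1) fun f hf => (hF f (hDQ.1 hf)).le).trans
        (Nat.mul_le_mul_right _ hp)
    have hmeet : ∀ f ∈ F, ∃ x ∈ U, x ∈ f := by
      intro f hf
      by_contra hno
      push Not at hno
      have hdisj : ∀ g ∈ D, f ∩ g = ∅ := fun g hg => by
        ext x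
        simp only [Finset.mem_inter, Finset.notMem_empty, iff_false, not_and]
        exact fun hx hxg => hno x (Finset.mem_biUnion.mpr ⟨g, hg, hxg⟩) hx
      have hfD : f ∉ D := fun h => by
        have h0 := hdisj f h
        rw [Finset.inter_self] at h0
        have := hF f hf
        simp [h0] at this
      have hQ : Q (insert f D) := by
        refine ⟨Finset.insert_subset hf hDQ.1, ?_⟩
        intro a ha b hb hab
        rcases Finset.mem_insert.mp ha with h1 | h1 <;> rcases Finset.mem_insert.mp hb with h2 | h2
        · exact absurd (h1.trans h2.symm) hab
        · rw [h1]; exact hdisj b h2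
        · rw [h2, Finset.inter_comm]; exact hdisj a h1
        · exact hDQ.2 a h1 b h2 hab
      have := hmax (insert f D) (Finset.mem_filter.mpr ⟨Finset.mem_powerset.mpr hQ.1, hQ⟩)
      rw [Finset.card_insert_of_notMem hfD] at this
      omega
    obtain ⟨x, hx⟩ : ∃ x, k.factorial * p ^ k < (F.filter fun f => x ∈ f).card := by
      by_contra hno
      push Not at hno
      have hsub : F ⊆ U.biUnion fun x => F.filter fun f => x ∈ f := fun f hf => by
        obtain ⟨x, hxU, hxf⟩ := hmeet f hf
        exact Finset.mem_biUnion.mpr ⟨x, hxU, Finset.mem_filter.mpr ⟨hf, hxf⟩⟩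
      have h1 := (Finset.card_le_card hsub).trans
        (Finset.card_biUnion_le_card_mul U _ _ fun x _ => hno x)
      have h2 : U.card * (k.factorial * p ^ k) ≤ p * (k + 1) * (k.factorial * p ^ k) :=
        Nat.mul_le_mul_right _ hU
      have h3 : p * (k + 1) * (k.factorial * p ^ k) = (k + 1).factorial * p ^ (k + 1) := by
        rw [Nat.factorial_succ, pow_succ]; ring
      omega
    have hinj : Set.InjOn (fun f : Finset V => f.erase x) (F.filter fun f => x ∈ f) := by
      intro a ha b hb hab
      have ha' := (Finset.mem_filter.mp ha).2
      have hb' := (Finset.mem_filter.mp hb).2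
      rw [← Finset.insert_erase ha', ← Finset.insert_erase hb']
      exact congrArg _ hab
    obtain ⟨K, F', hF', hp', hs1, hs2⟩ := exists_sunflower p k
      ((F.filter fun f => x ∈ f).image fun f => f.erase x)
      (by
        intro f hf
        obtain ⟨g, hg, rfl⟩ := Finset.mem_image.mp hf
        obtain ⟨hgF, hxg⟩ := Finset.mem_filter.mp hg
        rw [Finset.card_erase_of_mem hxg, hF g hgF]
        rfl)
      (by rwa [Finset.card_image_of_injOn hinj])
    have hnot : ∀ f ∈ F', x ∉ f ∧ insert x f ∈ F := by
      intro f hf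
      obtain ⟨g, hg, rfl⟩ := Finset.mem_image.mp (hF' hf)
      obtain ⟨hgF, hxg⟩ := Finset.mem_filter.mp hg
      exact ⟨Finset.notMem_erase x g, by rwa [Finset.insert_erase hxg]⟩
    refine ⟨insert x K, F'.image (insert x), ?_, ?_, ?_, ?_⟩
    · intro f hf
      obtain ⟨g, hg, rfl⟩ := Finset.mem_image.mp hf
      exact (hnot g hg).2
    · rwa [Finset.card_image_of_injOn]
      intro a ha b hb hab
      have h := congrArg (fun s : Finset V => s.erase x) hab
      simpa [Finset.erase_insert (hnot a ha).1, Finset.erase_insert (hnot b hb).1] using h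
    · intro f hf
      obtain ⟨g, hg, rfl⟩ := Finset.mem_image.mp hf
      exact Finset.insert_subset_insert x (hs1 g hg)
    · intro f hf g hg hfg
      obtain ⟨f', hf', rfl⟩ := Finset.mem_image.mp hf
      obtain ⟨g', hg', rfl⟩ := Finset.mem_image.mp hg
      rw [← Finset.insert_inter_distrib, hs2 f' hf' g' hg' fun h => hfg (h ▸ rfl)]

/-- The sets `f \ K` are pairwise disjoint, so if all of them met `U` there would be at most `|U|`
petals. -/
theorem IsSunflower.exists_inter_eq {K U : Finset V} {F : Finset (Finset V)}
    (h : IsSunflower K F) (hU : U.card < F.card) : ∃ f ∈ F, f ∩ U = K ∩ U := by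
  by_contra hno
  push Not at hno
  have hpt : ∀ f ∈ F, ∃ x ∈ U, x ∈ f ∧ x ∉ K := by
    intro f hf
    by_contra hx
    push Not at hx
    refine hno f hf (Finset.ext fun x => ?_)
    simp only [Finset.mem_inter]
    exact ⟨fun hxx => ⟨hx x hxx.2 hxx.1, hxx.2⟩, fun hxx => ⟨h.1 f hf hxx.1, hxx.2⟩⟩
  have : Nonempty V := by
    obtain ⟨f, hf⟩ := Finset.card_pos.mp ((Nat.zero_le _).trans_lt hU)
    exact ⟨(hpt f hf).choose⟩
  choose! φ hφU hφf hφK using hpt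
  obtain ⟨f, hf, g, hg, hfg, he⟩ :=
    Finset.exists_ne_map_eq_of_card_lt_of_maps_to hU (f := φ) fun f hf => hφU f hf
  have : φ f ∈ f ∩ g := Finset.mem_inter.mpr ⟨hφf f hf, by rw [he]; exact hφf g hg⟩
  rw [h.2 f hf g hg hfg] at this
  exact hφK f hf this

/-- `K` is an edge of `G`, or the kernel of a sunflower in `G` with at least `N |K|` petals. -/
def IsKernel (N : ℕ → ℕ) (G : Finset (Finset V)) (K : Finset V) : Prop :=
  K ∈ G ∨ ∃ F ⊆ G, N K.card ≤ F.card ∧ IsSunflower K F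

theorem IsKernel.mono {N N' : ℕ → ℕ} {G G' : Finset (Finset V)} {K : Finset V}
    (h : IsKernel N G K) (hN : ∀ s, N' s ≤ N s) (hG : G ⊆ G') : IsKernel N' G' K := by
  rcases h with h | ⟨F, hF, hc, hs⟩
  · exact Or.inl (hG h)
  · exact Or.inr ⟨F, hF.trans hG, (hN _).trans hc, hs⟩

theorem IsKernel.exists_inter_eq {N : ℕ → ℕ} {G : Finset (Finset V)} {K U : Finset V}
    (h : IsKernel N G K) (hU : U.card < N K.card) : ∃ f ∈ G, K ⊆ f ∧ f ∩ U = K ∩ U := by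
  rcases h with h | ⟨F, hF, hc, hs⟩
  · exact ⟨K, h, subset_rfl, rfl⟩
  · obtain ⟨f, hf, he⟩ := hs.exists_inter_eq (hU.trans_le hc)
    exact ⟨f, hF hf, hs.1 f hf, he⟩

/-- If the edges of `G` are `k`-sets whose pairwise intersections have sizes in `L`, then so have
the pairwise intersections of kernels. -/
theorem IsKernel.card_inter {N : ℕ → ℕ} {G : Finset (Finset V)} {k : ℕ} {L : ℕ → Prop}
    (hN : ∀ s, k < N s) (hk : ∀ e ∈ G, e.card = k) (hL : ∀ e ∈ G, ∀ f ∈ G, L (e ∩ f).card)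
    {K K' : Finset V} (h : IsKernel N G K) (h' : IsKernel N G K') : L (K ∩ K').card := by
  obtain ⟨e, he, hKe⟩ : ∃ e ∈ G, K' ⊆ e := by
    obtain ⟨e, he, h1, -⟩ := h'.exists_inter_eq (U := ∅) (by simpa using (Nat.zero_le k).trans_lt (hN _))
    exact ⟨e, he, h1⟩
  -- Replace `K` by an edge `f` with the same trace on `K'`, then `K'` by an edge `g` with the same
  -- trace on `f`; now `g ∩ f = K' ∩ K`.
  obtain ⟨f, hf, -, hfe⟩ := h.exists_inter_eq (U := K') (by
    have := Finset.card_le_card hKe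
    rw [hk e he] at this
    exact this.trans_lt (hN _))
  obtain ⟨g, hg, -, hge⟩ := h'.exists_inter_eq (U := f) (by rw [hk f hf]; exact hN _)
  have := hL g hg f hf
  rwa [hge, Finset.inter_comm, hfe] at this

/-- Kernels that pairwise meet in `T` can be extended to edges that pairwise meet in `T`. -/
theorem exists_extension_inter_eq {ι : Type*} [DecidableEq ι] {k : ℕ} {N : ℕ → ℕ}
    {G : Finset (Finset V)} (hk : ∀ e ∈ G, e.card = k) {T : Finset V} (Q : Finset ι)
    (κ : ι → Finset V) (hκ : ∀ i ∈ Q, IsKernel N G (κ i))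
    (hN : ∀ i ∈ Q, Q.card * k < N (κ i).card) (hc : ∀ i ∈ Q, (κ i).card ≤ k)
    (hT : ∀ i ∈ Q, ∀ j ∈ Q, i ≠ j → κ i ∩ κ j = T) :
    ∃ g : ι → Finset V, (∀ i ∈ Q, g i ∈ G) ∧ (∀ i ∈ Q, κ i ⊆ g i) ∧
      ∀ i ∈ Q, ∀ j ∈ Q, i ≠ j → g i ∩ g j = T := by
  -- Kernels are replaced by edges one at a time; each new edge agrees with its kernel on the union
  -- of all the other sets, so no pairwise intersection changes.
  suffices h : ∀ Q' ⊆ Q, ∃ g : ι → Finset V, (∀ i ∈ Q', g i ∈ G) ∧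
      (∀ i ∈ Q \ Q', g i = κ i) ∧ (∀ i ∈ Q, κ i ⊆ g i) ∧
      ∀ i ∈ Q, ∀ j ∈ Q, i ≠ j → g i ∩ g j = T by
    obtain ⟨g, h1, -, h2, h3⟩ := h Q subset_rfl
    exact ⟨g, h1, h2, h3⟩
  intro Q'
  induction Q' using Finset.induction_on with
  | empty => exact fun _ => ⟨κ, by simp, by simp, fun _ _ => subset_rfl, hT⟩
  | insert a Q' ha ih =>
    intro hQ'
    obtain ⟨g, h1, h2, h3, h4⟩ := ih ((Finset.subset_insert _ _).trans hQ')
    have haQ : a ∈ Q := hQ' (Finset.mem_insert_self _ _)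
    have hga : g a = κ a := h2 a (Finset.mem_sdiff.mpr ⟨haQ, ha⟩)
    have hgc : ∀ i ∈ Q, (g i).card ≤ k := fun i hi => by
      by_cases hi' : i ∈ Q'
      · exact (hk _ (h1 i hi')).le
      · rw [h2 i (Finset.mem_sdiff.mpr ⟨hi, hi'⟩)]; exact hc i hi
    obtain ⟨f, hf, hκf, hfU⟩ := (hκ a haQ).exists_inter_eq (U := (Q.erase a).biUnion g) (by
      refine lt_of_le_of_lt (Finset.card_biUnion_le_card_mul _ _ k fun i hi =>
        hgc i (Finset.mem_of_mem_erase hi)) (lt_of_le_of_lt ?_ (hN a haQ))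
      exact Nat.mul_le_mul_right _ (Finset.card_le_card (Finset.erase_subset _ _)))
    have hfg : ∀ j ∈ Q, j ≠ a → f ∩ g j = T := by
      intro j hj hja
      have hsub : g j ⊆ (Q.erase a).biUnion g :=
        Finset.subset_biUnion_of_mem g (Finset.mem_erase.mpr ⟨hja, hj⟩)
      rw [← h4 a haQ j hj hja.symm, hga]
      have := congrArg (· ∩ g j) hfU
      simpa [Finset.inter_assoc, Finset.inter_eq_right.mpr hsub] using this
    refine ⟨Function.update g a f, ?_, ?_, ?_, ?_⟩
    · intro i hi
      by_cases hia : i = a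
      · subst hia; simpa using hf
      · rw [Function.update_of_ne hia]
        exact h1 i ((Finset.mem_insert.mp hi).resolve_left hia)
    · intro i hi
      simp only [Finset.mem_sdiff, Finset.mem_insert, not_or] at hi
      rw [Function.update_of_ne hi.2.1]
      exact h2 i (Finset.mem_sdiff.mpr ⟨hi.1, hi.2.2⟩)
    · intro i hi
      by_cases hia : i = a
      · subst hia; simpa using hκf
      · rw [Function.update_of_ne hia]; exact h3 i hi
    · intro i hi j hj hij
      by_cases hia : i = a
      · subst hia
        rw [Function.update_self, Function.update_of_ne hij.symm]
        exact hfg j hj hij.symm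
      · rw [Function.update_of_ne hia]
        by_cases hja : j = a
        · subst hja
          rw [Function.update_self, Finset.inter_comm]
          exact hfg i hi hij
        · rw [Function.update_of_ne hja]; exact h4 i hi j hj hij

/-! ### Typical edges and covered subfamilies -/

/-- The number of petals that the kernel of a sunflower of `k`-sets must have, as a function of
the size of the kernel. -/
def petals (k s : ℕ) : ℕ := 2 ^ ((k + 1) * (s + 1))

theorem lt_petals (k s : ℕ) : k + 1 < petals k s := by
  refine Nat.lt_two_pow_self.trans_le (Nat.pow_le_pow_right two_pos ?_)
  exact Nat.le_mul_of_pos_right _ (Nat.succ_pos s)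

/-- Every kernel `K` lies in an edge `f` such that all kernels in `f` meet `K` in a kernel. -/
theorem IsKernel.exists_typical {k : ℕ} {G : Finset (Finset V)} (hk : ∀ e ∈ G, e.card = k)
    {K : Finset V} (h : IsKernel (petals k) G K) :
    ∃ f ∈ G, K ⊆ f ∧ ∀ K' ⊆ f, IsKernel (petals k) G K' → IsKernel (petals k) G (K' ∩ K) := by
  rcases h with h | ⟨F, hFG, hc, hs⟩
  · exact ⟨K, h, subset_rfl, fun K' hK' hker => by rwa [Finset.inter_eq_left.mpr hK']⟩
  have hKer : IsKernel (petals k) G K := Or.inr ⟨F, hFG, hc, hs⟩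
  have hpos : ∀ s, 0 < petals k s := fun s => (Nat.zero_le _).trans_lt (lt_petals k s)
  by_contra hno
  push Not at hno
  have hno' : ∀ f : Finset V, ∃ K' : Finset V, f ∈ F →
      K' ⊆ f ∧ IsKernel (petals k) G K' ∧ ¬ IsKernel (petals k) G (K' ∩ K) := fun f => by
    by_cases hf : f ∈ F
    · obtain ⟨K', h1, h2, h3⟩ := hno f (hFG hf) (hs.1 f hf)
      exact ⟨K', fun _ => ⟨h1, h2, h3⟩⟩
    · exact ⟨∅, fun h => absurd h hf⟩
  choose κ hκ using hno'
  obtain ⟨f₀, hf₀⟩ : F.Nonempty := Finset.card_pos.mp ((hpos _).trans_le hc)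
  have hKk : K.card ≤ k := by
    rw [← hk f₀ (hFG hf₀)]; exact Finset.card_le_card (hs.1 f₀ hf₀)
  -- There are `2 ^ |K|` possible traces on `K` and `|K| ≤ k`, so some trace `T` is shared by `2 ^
  -- ((k + 1) * |K|)` petals. As `T` is a proper subset of `K`, this is at least `petals k |T|`.
  obtain ⟨T, hTK, hT⟩ := Finset.exists_le_card_fiber_of_mul_le_card_of_maps_to (s := F)
    (t := K.powerset) (f := fun f => κ f ∩ K) (n := 2 ^ ((k + 1) * K.card))
    (fun f _ => Finset.mem_powerset.mpr Finset.inter_subset_right) ⟨K, by simp⟩ (by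
      rw [Finset.card_powerset, ← pow_add]
      exact (Nat.pow_le_pow_right two_pos (by nlinarith)).trans hc)
  rw [Finset.mem_powerset] at hTK
  set FT := F.filter fun f => κ f ∩ K = T
  obtain ⟨f₁, hf₁⟩ : FT.Nonempty := Finset.card_pos.mp (lt_of_lt_of_le (by positivity) hT)
  have hTno : ¬ IsKernel (petals k) G T := by
    obtain ⟨hF, he⟩ := Finset.mem_filter.mp hf₁
    rw [← he]
    exact (hκ f₁ hF).2.2
  have hTlt : T.card < K.card :=
    Finset.card_lt_card (hTK.ssubset_of_ne fun h => hTno (h ▸ hKer))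
  obtain ⟨Q, hQ, hQc⟩ := Finset.exists_subset_card_eq (s := FT) (n := petals k T.card)
    ((Nat.pow_le_pow_right two_pos (Nat.mul_le_mul_left _ hTlt)).trans hT)
  have hQF : ∀ f ∈ Q, f ∈ F ∧ κ f ∩ K = T := fun f hf => Finset.mem_filter.mp (hQ hf)
  have hQκ : ∀ f ∈ Q, T ⊂ κ f := fun f hf => by
    have h1 : T ⊆ κ f := by rw [← (hQF f hf).2]; exact Finset.inter_subset_left
    exact h1.ssubset_of_ne fun h => hTno (h ▸ (hκ f (hQF f hf).1).2.1)
  -- Distinct petals meet in `K`, so the `κ f` pairwise meet exactly in `T`. Each is larger than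
  -- `T`, and one more vertex multiplies `petals` by `2 ^ (k + 1) > k`, which leaves room to extend
  -- all of them to edges. These make `T` a kernel after all.
  obtain ⟨g, hg1, hg2, hg3⟩ := exists_extension_inter_eq (N := petals k) hk (T := T) Q κ
    (fun f hf => (hκ f (hQF f hf).1).2.1)
    (fun f hf => by
      have h1 : T.card + 1 ≤ (κ f).card := Finset.card_lt_card (hQκ f hf)
      have h2 : petals k (T.card + 1) ≤ petals k (κ f).card :=
        Nat.pow_le_pow_right two_pos (Nat.mul_le_mul_left _ (Nat.succ_le_succ h1))
      refine lt_of_lt_of_le ?_ h2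
      have h3 : petals k (T.card + 1) = petals k T.card * 2 ^ (k + 1) := by
        rw [petals, petals, ← pow_add]; ring_nf
      rw [hQc, h3]
      exact Nat.mul_lt_mul_of_pos_left (k.lt_succ_self.trans Nat.lt_two_pow_self) (hpos _))
    (fun f hf => by
      rw [← hk f (hFG (hQF f hf).1)]
      exact Finset.card_le_card (hκ f (hQF f hf).1).1)
    (fun f hf f' hf' hne => by
      obtain ⟨hfF, hfT⟩ := hQF f hf
      obtain ⟨hfF', hfT'⟩ := hQF f' hf'
      have h1 : κ f ∩ κ f' ⊆ K := by
        rw [← hs.2 f hfF f' hfF' hne]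
        exact Finset.inter_subset_inter (hκ f hfF).1 (hκ f' hfF').1
      refine Finset.Subset.antisymm (fun x hx => ?_)
        (Finset.subset_inter (hQκ f hf).1 (hQκ f' hf').1)
      rw [← hfT]
      exact Finset.mem_inter.mpr ⟨(Finset.mem_inter.mp hx).1, h1 hx⟩)
  refine hTno (Or.inr ⟨Q.image g, ?_, ?_, ?_, ?_⟩)
  · intro e he
    obtain ⟨f, hf, rfl⟩ := Finset.mem_image.mp he
    exact hg1 f hf
  · rw [Finset.card_image_of_injOn, hQc]
    intro a ha b hb hab
    by_contra hne
    have h1 := hg3 a ha b hb hne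
    rw [← (show g a = g b from hab), Finset.inter_self] at h1
    have h2 := hk _ (hg1 a ha)
    rw [h1] at h2
    omega
  · intro e he
    obtain ⟨f, hf, rfl⟩ := Finset.mem_image.mp he
    exact (hQκ f hf).1.trans (hg2 f hf)
  · intro e he e' he' hne
    obtain ⟨f, hf, rfl⟩ := Finset.mem_image.mp he
    obtain ⟨f', hf', rfl⟩ := Finset.mem_image.mp he'
    exact hg3 f hf f' hf' fun h => hne (h ▸ rfl)

/-- Every family of `k`-sets has a large subfamily `G'` in which every `(j+1)`-subset of an edge
`h` that meets `R` lies in a kernel of `G'` properly contained in `h`. -/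
theorem exists_covered_subfamily [Fintype V] {k j p : ℕ} {N : ℕ → ℕ} (hp : 1 ≤ p)
    (hN : ∀ s < k, N s ≤ p + 1) (R : Finset V) (G : Finset (Finset V))
    (hk : ∀ e ∈ G, e.card = k) :
    ∃ G' ⊆ G, (∀ h ∈ G', ∀ X ⊆ h, X.card = j + 1 → (X ∩ R).Nonempty →
        ∃ K, IsKernel N G' K ∧ X ⊆ K ∧ K ⊂ h) ∧
      (G \ G').card ≤ R.card * Fintype.card V ^ j * (k.factorial * p ^ k) := by
  -- Bad edges are deleted one at a time, and `ψ h` records the uncovered set for which `h` was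
  -- deleted. Among edges with `ψ = X` there is no sunflower with more than `p` petals: when its
  -- first edge was deleted, its kernel would have covered `X`.
  have key : ∀ (m : ℕ) (G : Finset (Finset V)), G.card = m → (∀ e ∈ G, e.card = k) →
      ∃ G' ⊆ G, (∀ h ∈ G', ∀ X ⊆ h, X.card = j + 1 → (X ∩ R).Nonempty →
        ∃ K, IsKernel N G' K ∧ X ⊆ K ∧ K ⊂ h) ∧
      ∃ ψ : Finset V → Finset V,
        (∀ h ∈ G \ G', ψ h ⊆ h ∧ (ψ h).card = j + 1 ∧ (ψ h ∩ R).Nonempty) ∧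
        ∀ F ⊆ G \ G', ∀ X K, (∀ f ∈ F, ψ f = X) → IsSunflower K F → F.card ≤ p := by
    intro m
    induction m with
    | zero =>
      intro G hG _
      rw [Finset.card_eq_zero] at hG
      subst hG
      refine ⟨∅, subset_rfl, by simp, fun _ => ∅, by simp, ?_⟩
      intro F hF X K _ _
      have : F = ∅ := by simpa using hF
      simp [this]
    | succ m ih =>
      intro G hG hk
      by_cases hgood : ∀ h ∈ G, ∀ X ⊆ h, X.card = j + 1 → (X ∩ R).Nonempty →
        ∃ K, IsKernel N G K ∧ X ⊆ K ∧ K ⊂ h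
      · refine ⟨G, subset_rfl, hgood, fun _ => ∅, by simp, ?_⟩
        intro F hF X K _ _
        have : F = ∅ := by simpa using hF
        simp [this]
      · push Not at hgood
        obtain ⟨h, hh, X, hXh, hXc, hXR, hbad⟩ := hgood
        obtain ⟨G', hG', hcov, ψ, hψ, hsun⟩ := ih (G.erase h)
          (by rw [Finset.card_erase_of_mem hh, hG]; rfl)
          (fun e he => hk e (Finset.mem_of_mem_erase he))
        have hhG' : h ∉ G' := fun h' => Finset.notMem_erase h G (hG' h')
        refine ⟨G', hG'.trans (Finset.erase_subset _ _), hcov, Function.update ψ h X, ?_, ?_⟩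
        · intro e he
          by_cases heh : e = h
          · subst heh
            rw [Function.update_self]
            exact ⟨hXh, hXc, hXR⟩
          · rw [Function.update_of_ne heh]
            obtain ⟨h1, h2⟩ := Finset.mem_sdiff.mp he
            exact hψ e (Finset.mem_sdiff.mpr ⟨Finset.mem_erase.mpr ⟨heh, h1⟩, h2⟩)
        · intro F hF Y K hY hs
          by_contra hlt
          push Not at hlt
          have hFG : F ⊆ G := hF.trans Finset.sdiff_subset
          by_cases hhF : h ∈ F
          · have hYX : Y = X := by rw [← hY h hhF, Function.update_self]
            have hYf : ∀ f ∈ F, X ⊆ f := by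
              intro f hf
              by_cases hfh : f = h
              · rwa [hfh]
              · have h1 := hY f hf
                rw [Function.update_of_ne hfh] at h1
                rw [← hYX, ← h1]
                obtain ⟨h2, h3⟩ := Finset.mem_sdiff.mp (hF hf)
                exact (hψ f (Finset.mem_sdiff.mpr ⟨Finset.mem_erase.mpr ⟨hfh, h2⟩, h3⟩)).1
            obtain ⟨f, hf, hfh⟩ := Finset.exists_mem_ne (hp.trans_lt hlt) h
            have hK : h ∩ f = K := hs.2 h hhF f hf hfh.symm
            have hKh : K ⊂ h := by
              refine (hs.1 h hhF).ssubset_of_ne fun he => hfh ?_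
              rw [he] at hK
              refine (Finset.eq_of_subset_of_card_le (Finset.inter_eq_left.mp hK) ?_).symm
              rw [hk f (hFG hf), hk h hh]
            refine hbad K (Or.inr ⟨F, hFG, (hN _ ?_).trans hlt, hs⟩) ?_ hKh
            · rw [← hk h hh]; exact Finset.card_lt_card hKh
            · rw [← hK]; exact Finset.subset_inter hXh (hYf f hf)
          · refine absurd (hsun F ?_ Y K ?_ hs) (not_le.mpr hlt)
            · intro f hf
              obtain ⟨h1, h2⟩ := Finset.mem_sdiff.mp (hF hf)
              exact Finset.mem_sdiff.mpr
                ⟨Finset.mem_erase.mpr ⟨fun he => hhF (he ▸ hf), h1⟩, h2⟩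
            · intro f hf
              have hne : f ≠ h := fun he => hhF (he ▸ hf)
              rw [← hY f hf, Function.update_of_ne hne]
  obtain ⟨G', hG', hcov, ψ, hψ, hsun⟩ := key _ G rfl hk
  refine ⟨G', hG', hcov, ?_⟩
  let 𝒳 := (R ×ˢ (Finset.univ : Finset V).powersetCard j).image fun q => insert q.1 q.2
  have h𝒳 : 𝒳.card ≤ R.card * Fintype.card V ^ j := by
    refine Finset.card_image_le.trans ?_
    rw [Finset.card_product, Finset.card_powersetCard, Finset.card_univ]
    exact Nat.mul_le_mul_left _ (Nat.choose_le_pow _ _)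
  have hmaps : ∀ h ∈ G \ G', ψ h ∈ 𝒳 := by
    intro h hh
    obtain ⟨-, h2, u, hu⟩ := hψ h hh
    obtain ⟨hu1, hu2⟩ := Finset.mem_inter.mp hu
    refine Finset.mem_image.mpr ⟨(u, (ψ h).erase u), Finset.mem_product.mpr ⟨hu2, ?_⟩,
      Finset.insert_erase hu1⟩
    rw [Finset.mem_powersetCard]
    exact ⟨Finset.subset_univ _, by rw [Finset.card_erase_of_mem hu1, h2]; rfl⟩
  have hfib : ∀ X ∈ 𝒳, ((G \ G').filter fun h => ψ h = X).card ≤ k.factorial * p ^ k := by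
    intro X _
    by_contra hlt
    push Not at hlt
    obtain ⟨K, F, hF, hpF, hs⟩ := exists_sunflower p k _ (fun f hf =>
      hk f (Finset.mem_sdiff.mp (Finset.mem_filter.mp hf).1).1) hlt
    exact absurd (hsun F (hF.trans (Finset.filter_subset _ _)) X K
      (fun f hf => (Finset.mem_filter.mp (hF hf)).2) hs) (not_le.mpr hpF)
  calc (G \ G').card ≤ k.factorial * p ^ k * 𝒳.card :=
        Finset.card_le_mul_card_image_of_maps_to hmaps _ hfib
    _ ≤ k.factorial * p ^ k * (R.card * Fintype.card V ^ j) := Nat.mul_le_mul_left _ h𝒳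
    _ = _ := Nat.mul_comm _ _

/-! ### Admissible sizes, teams and body vertices -/

/-- The admissible intersection sizes: multiples of `t`, and numbers that are at least `l(t-1)`. -/
def Admissible (l t a : ℕ) : Prop := t ∣ a ∨ l * (t - 1) ≤ a

/-- `lt`-uniform hypergraphs, where `t ∣ l`, whose intersection sizes are admissible. -/
structure IsAdmissibleSystem (l t : ℕ) (H : Finset (Finset V)) : Prop where
  two_le : 2 ≤ t
  pos : 0 < l
  dvd : t ∣ l
  card_eq : ∀ e ∈ H, e.card = l * t
  inter : ∀ e ∈ H, ∀ f ∈ H, Admissible l t (e ∩ f).card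

/-- Edges of `H` and kernels of sunflowers in `H` with more than `lt` petals. -/
def WeakKernel (l t : ℕ) (H : Finset (Finset V)) (K : Finset V) : Prop :=
  IsKernel (fun _ => l * t + 1) H K

/-- `v` lies in a kernel with `t` elements. -/
def IsTeamVertex (l t : ℕ) (H : Finset (Finset V)) (v : V) : Prop :=
  ∃ W, WeakKernel l t H W ∧ W.card = t ∧ v ∈ W

/-- `v` lies in the body of a star of `H` with centre `S`, in the sense that both `S` and
`S ∪ {v}` are kernels. -/
def IsBodyVertex (l t : ℕ) (H : Finset (Finset V)) (S : Finset V) (v : V) : Prop :=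
  WeakKernel l t H S ∧ S.card = l * (t - 1) ∧ v ∉ S ∧ WeakKernel l t H (insert v S)

/-- The threshold `l * (t - 1)` is itself a multiple of `t`. Hence up to and including it admissible
means divisible by `t`, and `t` would divide `d`. -/
theorem Admissible.lt_of_add {l t a d : ℕ} (htl : t ∣ l) (h : Admissible l t a)
    (h' : Admissible l t (a + d)) (hd : 0 < d) (hdt : d < t) : l * (t - 1) < a + d := by
  have hc : t ∣ l * (t - 1) := htl.mul_right _
  by_contra hlt
  push Not at hlt
  have h1 : t ∣ a := h.elim id fun h => by omega
  have h2 : t ∣ a + d := h'.elim id fun h => by rwa [le_antisymm hlt h]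
  exact Nat.not_dvd_of_pos_of_lt hd hdt ((Nat.dvd_add_right h1).mp h2)

namespace IsAdmissibleSystem

variable {l t : ℕ} {H : Finset (Finset V)}

theorem le_l (h : IsAdmissibleSystem l t H) : t ≤ l := Nat.le_of_dvd h.pos h.dvd

theorem le_centre (h : IsAdmissibleSystem l t H) : t ≤ l * (t - 1) :=
  h.le_l.trans (Nat.le_mul_of_pos_right _ (by have := h.two_le; omega))

theorem centre_add (h : IsAdmissibleSystem l t H) : l * (t - 1) + l = l * t := by
  have := h.two_le
  obtain ⟨s, rfl⟩ : ∃ s, t = s + 1 := ⟨t - 1, by omega⟩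
  simp [Nat.mul_succ]

theorem card_inter (h : IsAdmissibleSystem l t H) {K K' : Finset V} (hK : WeakKernel l t H K)
    (hK' : WeakKernel l t H K') : Admissible l t (K ∩ K').card :=
  IsKernel.card_inter (fun _ => Nat.lt_succ_self _) h.card_eq h.inter hK hK'

theorem card_kernel (h : IsAdmissibleSystem l t H) {K : Finset V} (hK : WeakKernel l t H K) :
    Admissible l t K.card := by
  have := h.card_inter hK hK
  rwa [Finset.inter_self] at this

/-- Since `t ≤ l * (t - 1)`, the only admissible sizes up to `t` are `0` and `t`. This makes teams
inseparable and pairwise disjoint. -/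
theorem team_inter (h : IsAdmissibleSystem l t H) {W K : Finset V} (hW : WeakKernel l t H W)
    (hWt : W.card = t) (hK : WeakKernel l t H K) : W ∩ K = ∅ ∨ W ⊆ K := by
  have hle : (W ∩ K).card ≤ t := hWt ▸ Finset.card_le_card Finset.inter_subset_left
  have hfull : (W ∩ K).card = t → W ⊆ K := fun he =>
    Finset.inter_eq_left.mp (Finset.eq_of_subset_of_card_le Finset.inter_subset_left
      (by rw [he, hWt]))
  rcases h.card_inter hW hK with hd | hc
  · rcases Nat.eq_zero_or_pos (W ∩ K).card with h0 | h0
    · exact Or.inl (Finset.card_eq_zero.mp h0)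
    · exact Or.inr (hfull (le_antisymm hle (Nat.le_of_dvd h0 hd)))
  · exact Or.inr (hfull (le_antisymm hle (h.le_centre.trans hc)))

/-- Both `|S ∩ K|` and `|S ∩ K| + 1` are admissible, so the latter exceeds `l * (t - 1) = |S|`.
Uniqueness of centres and condition (iii) on stars follow from this. -/
theorem centre_subset (h : IsAdmissibleSystem l t H) {S K : Finset V} {v : V}
    (hS : IsBodyVertex l t H S v) (hK : WeakKernel l t H K) (hv : v ∈ K) : S ⊆ K := by
  obtain ⟨h1, h2, h3, h4⟩ := hS
  have ha := h.card_inter h1 hK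
  have hb := h.card_inter h4 hK
  rw [Finset.insert_inter_of_mem hv, Finset.card_insert_of_notMem
    (fun hx => h3 (Finset.mem_inter.mp hx).1)] at hb
  have := Admissible.lt_of_add h.dvd ha hb one_pos h.two_le
  exact Finset.inter_eq_left.mp (Finset.eq_of_subset_of_card_le Finset.inter_subset_left
    (by omega))

theorem centre_unique (h : IsAdmissibleSystem l t H) {S S' : Finset V} {v : V}
    (hS : IsBodyVertex l t H S v) (hS' : IsBodyVertex l t H S' v) : S = S' := by
  have h1 := h.centre_subset hS hS'.2.2.2 (Finset.mem_insert_self _ _)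
  refine Finset.eq_of_subset_of_card_le
    (((Finset.subset_insert_iff_of_notMem hS.2.2.1).mp h1)) ?_
  rw [hS.2.1, hS'.2.1]

theorem not_mem_centre (h : IsAdmissibleSystem l t H) {S S' : Finset V} {v w : V}
    (hS : IsBodyVertex l t H S v) (hS' : IsBodyVertex l t H S' w) : w ∉ S := fun hw => by
  have h1 := h.centre_subset hS' hS.1 hw
  have h2 := Finset.eq_of_subset_of_card_le h1 (by rw [hS.2.1, hS'.2.1])
  exact hS'.2.2.1 (h2 ▸ hw)

theorem not_isTeamVertex (h : IsAdmissibleSystem l t H) {S : Finset V} {v : V}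
    (hS : IsBodyVertex l t H S v) : ¬ IsTeamVertex l t H v := fun ⟨W, hW, hWt, hv⟩ => by
  have h1 := Finset.card_le_card
    (Finset.insert_subset hv (h.centre_subset hS hW hv))
  rw [Finset.card_insert_of_notMem hS.2.2.1, hS.2.1, hWt] at h1
  have := h.le_centre
  omega

/-- A team through `v` would lie inside `K` and avoid `K'`, hence fit into the fewer than `t`
vertices of `K \ K'`. -/
theorem isTeamVertex_of_subset (h : IsAdmissibleSystem l t H) {K K' : Finset V}
    (hK : WeakKernel l t H K) (hK' : WeakKernel l t H K') {v : V} (hvK : v ∈ K) (hvK' : v ∉ K')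
    (hc : (K \ K').card < t) : ¬ IsTeamVertex l t H v := fun ⟨W, hW, hWt, hv⟩ => by
  have h1 : W ⊆ K := (h.team_inter hW hWt hK).resolve_left fun h0 =>
    Finset.notMem_empty v (h0 ▸ Finset.mem_inter.mpr ⟨hv, hvK⟩)
  have h2 : W ∩ K' = ∅ := (h.team_inter hW hWt hK').resolve_right fun h0 => hvK' (h0 hv)
  have h3 : W ⊆ K \ K' := fun x hx => Finset.mem_sdiff.mpr ⟨h1 hx, fun hx' =>
    Finset.notMem_empty x (h2 ▸ Finset.mem_inter.mpr ⟨hx, hx'⟩)⟩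
  have := Finset.card_le_card h3
  omega

end IsAdmissibleSystem

/-! ### A covered family without mixed edges is empty -/

/-- Edges of `G` and kernels of large sunflowers in `G`. -/
def StrongKernel (l t : ℕ) (G : Finset (Finset V)) (K : Finset V) : Prop :=
  IsKernel (petals (l * t)) G K

/-- All strong kernels contained in the edge `f` meet `K` in a strong kernel. -/
def IsTypical (l t : ℕ) (G : Finset (Finset V)) (K f : Finset V) : Prop :=
  f ∈ G ∧ K ⊆ f ∧ ∀ K' ⊆ f, StrongKernel l t G K' → StrongKernel l t G (K' ∩ K)

/-- `G ⊆ H` has the property that every set of fewer than `l` vertices of an edge `h` of `G`, one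
of which is neither a team vertex nor a body vertex, lies in a strong kernel properly contained
in `h`. -/
structure IsCoveredFamily (l t : ℕ) (H G : Finset (Finset V)) (R : Finset V) : Prop where
  sys : IsAdmissibleSystem l t H
  subset : G ⊆ H
  mem_R : ∀ v, v ∈ R ↔ ¬ IsTeamVertex l t H v ∧ ∀ S, ¬ IsBodyVertex l t H S v
  cover : ∀ h ∈ G, ∀ X ⊆ h, X.card < l → (X ∩ R).Nonempty →
    ∃ K, StrongKernel l t G K ∧ X ⊆ K ∧ K ⊂ h

namespace IsCoveredFamily

variable {l t : ℕ} {H G : Finset (Finset V)} {R : Finset V}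

theorem card_eq (h : IsCoveredFamily l t H G R) {e : Finset V} (he : e ∈ G) : e.card = l * t :=
  h.sys.card_eq e (h.subset he)

theorem strong (_ : IsCoveredFamily l t H G R) {e : Finset V} (he : e ∈ G) :
    StrongKernel l t G e := Or.inl he

theorem weak (h : IsCoveredFamily l t H G R) {K : Finset V} (hK : StrongKernel l t G K) :
    WeakKernel l t H K :=
  IsKernel.mono hK (fun s => (lt_petals _ s).le) h.subset

theorem exists_typical (h : IsCoveredFamily l t H G R) {K : Finset V}
    (hK : StrongKernel l t G K) : ∃ f, IsTypical l t G K f := by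
  obtain ⟨f, h1, h2, h3⟩ := IsKernel.exists_typical (fun e he => h.card_eq he) hK
  exact ⟨f, h1, h2, h3⟩

theorem eq_erase_of_subset {f K : Finset V} {z : V}
    (hz : f.erase z ⊆ K) (hK : K ⊂ f) : K = f.erase z := by
  refine Finset.Subset.antisymm (fun x hx => Finset.mem_erase.mpr ⟨fun hxz => ?_, hK.1 hx⟩) hz
  subst hxz
  refine hK.2 fun y hy => ?_
  by_cases hyx : y = x
  · rwa [hyx]
  · exact hz (Finset.mem_erase.mpr ⟨hyx, hy⟩)

/-- A vertex outside the teams and bodies lies in the centre at any body vertex that shares an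
edge of `G` with it. -/
theorem mem_centre_of_isBodyVertex (h : IsCoveredFamily l t H G R) {e S : Finset V} {x v : V}
    (he : e ∈ G) (hx : x ∈ e) (hv : v ∈ e) (hS : IsBodyVertex l t H S v) (hxR : x ∈ R) :
    x ∈ S := by
  by_contra hxS
  have hxv : x ≠ v := fun hxv => ((h.mem_R x).mp hxR).2 S (hxv ▸ hS)
  -- The aim is to show that a minimal strong kernel `M` through `x` and `v` is `S ∪ {x, v}`, and
  -- then that `x` is a body vertex with the same centre `S`, contrary to `x ∈ R`.
  obtain ⟨M, hM⟩ := exists_minimal_of_wellFoundedLT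
    (fun M : Finset V => StrongKernel l t G M ∧ x ∈ M ∧ v ∈ M) ⟨e, h.strong he, hx, hv⟩
  obtain ⟨⟨hMs, hxM, hvM⟩, hmin⟩ := hM
  obtain ⟨f, hfG, hMf, hftyp⟩ := h.exists_typical hMs
  have hSM : S ⊆ M := h.sys.centre_subset hS (h.weak hMs) hvM
  have hSf : S ⊆ f := hSM.trans hMf
  have hxf := hMf hxM
  have hvf := hMf hvM
  have hfc := h.card_eq hfG
  have hvS := hS.2.2.1
  have hSc := hS.2.1
  have hca := h.sys.centre_add
  set Z := ((f \ S).erase x).erase v with hZ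
  have hZc : Z.card + 2 = l := by
    have h1 : v ∈ (f \ S).erase x := by simp [hvf, hvS, hxv.symm]
    have h2 : x ∈ f \ S := by simp [hxf, hxS]
    have h3 := Finset.card_sdiff_add_card_eq_card hSf
    rw [← Finset.card_erase_add_one h2, ← Finset.card_erase_add_one h1, ← hZ] at h3
    omega
  have hZf : Z ⊆ f := (Finset.erase_subset _ _).trans
    ((Finset.erase_subset _ _).trans Finset.sdiff_subset)
  have hvZ : v ∉ Z := Finset.notMem_erase _ _
  have hxZ : x ∉ Z := fun hx => Finset.notMem_erase x (f \ S) (Finset.mem_of_mem_erase hx)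
  have hfZ : ∀ y ∈ f, y ∈ S ∨ y = x ∨ y = v ∨ y ∈ Z := by
    intro y hy
    by_cases h1 : y ∈ S
    · exact Or.inl h1
    by_cases h2 : y = x
    · exact Or.inr (Or.inl h2)
    by_cases h3 : y = v
    · exact Or.inr (Or.inr (Or.inl h3))
    · exact Or.inr (Or.inr (Or.inr (by simp [hZ, h1, h2, h3, hy])))
  -- A kernel covering `x`, `v` and `Z` without `z` contains `S` as well, so it is `f.erase z`; if
  -- `z ∈ M`, its intersection with `M` contradicts minimality.
  have hZM : ∀ z ∈ Z, z ∉ M := by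
    intro z hz hzM
    have hzv : z ≠ v := fun he => hvZ (he ▸ hz)
    have hzx : z ≠ x := fun he => hxZ (he ▸ hz)
    obtain ⟨K, hK, hXK, hKf⟩ := h.cover f hfG (insert x (insert v (Z.erase z)))
      (Finset.insert_subset hxf (Finset.insert_subset hvf ((Finset.erase_subset _ _).trans hZf)))
      (by
        have h1 := Finset.card_insert_le x (insert v (Z.erase z))
        have h2 := Finset.card_insert_le v (Z.erase z)
        have h3 := Finset.card_erase_add_one hz
        omega)
      ⟨x, by simp [hxR]⟩
    have hxK : x ∈ K := hXK (by simp)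
    have hvK : v ∈ K := hXK (by simp)
    have hSK := h.sys.centre_subset hS (h.weak hK) hvK
    have hsub : f.erase z ⊆ K := by
      intro y hy
      obtain ⟨hyz, hyf⟩ := Finset.mem_erase.mp hy
      rcases hfZ y hyf with h1 | rfl | rfl | h1
      · exact hSK h1
      · exact hxK
      · exact hvK
      · exact hXK (by simp [hyz, h1])
    rw [eq_erase_of_subset hsub hKf] at hK
    have h1 := hmin ⟨hftyp _ (Finset.erase_subset _ _) hK, by simp [hxM, hxf, hzx.symm],
      by simp [hvM, hvf, hzv.symm]⟩ Finset.inter_subset_right hzM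
    simp at h1
  -- Here `K` must miss `v`, since otherwise it would contain `S` and be all of `f`. So `K ∩ M` is
  -- `S ∩ K` together with `x`, and rigidity of the sizes forces `S ⊆ K`.
  obtain ⟨K, hK, hXK, hKf⟩ := h.cover f hfG (insert x Z) (Finset.insert_subset hxf hZf)
    (by
      have := Finset.card_insert_le x Z
      omega) ⟨x, by simp [hxR]⟩
  have hxK : x ∈ K := hXK (by simp)
  have hvK : v ∉ K := by
    intro hvK
    have hSK := h.sys.centre_subset hS (h.weak hK) hvK
    refine hKf.2 fun y hy => ?_
    rcases hfZ y hy with h1 | rfl | rfl | h1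
    · exact hSK h1
    · exact hxK
    · exact hvK
    · exact hXK (by simp [h1])
  have hKM : K ∩ M = insert x (S ∩ K) := by
    ext y
    simp only [Finset.mem_inter, Finset.mem_insert]
    constructor
    · rintro ⟨hyK, hyM⟩
      rcases hfZ y (hMf hyM) with h1 | h1 | rfl | h1
      · exact Or.inr ⟨h1, hyK⟩
      · exact Or.inl h1
      · exact absurd hyK hvK
      · exact absurd hyM (hZM y h1)
    · rintro (rfl | ⟨h1, h2⟩)
      · exact ⟨hxK, hxM⟩
      · exact ⟨h2, hSM h1⟩
  have hKMs : StrongKernel l t G (insert x (S ∩ K)) := hKM ▸ hftyp K hKf.1 hK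
  have ha := h.sys.card_inter hS.1 (h.weak hK)
  have hb := h.sys.card_kernel (h.weak hKMs)
  rw [Finset.card_insert_of_notMem fun hx => hxS (Finset.mem_inter.mp hx).1] at hb
  have hlt := Admissible.lt_of_add h.sys.dvd ha hb one_pos h.sys.two_le
  have hSK : S ∩ K = S := Finset.eq_of_subset_of_card_le Finset.inter_subset_left (by omega)
  rw [hSK] at hKMs
  exact ((h.mem_R x).mp hxR).2 S ⟨hS.1, hSc, hxS, h.weak hKMs⟩

/-- Since `f` is typical and `K` minimal, any strong kernel inside `f` through `g` contains all of
`K`. So `g` and fewer than `l - 1` vertices of `f \ K` are covered by a proper subset of `f`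
containing `K`. Therefore `f \ K` has at least `l - 1` vertices, and not more because `K` is large;
covering all of them but `z` yields `f.erase z`. -/
theorem card_sdiff_minimal (h : IsCoveredFamily l t H G R) {K f : Finset V} {g : V}
    (hgR : g ∈ R) (hgK : g ∈ K)
    (hmin : ∀ K', StrongKernel l t G K' → g ∈ K' → K' ⊆ K → K ⊆ K')
    (hc : l * (t - 1) < K.card) (hf : IsTypical l t G K f) :
    (f \ K).card + 1 = l ∧ ∀ z ∈ f \ K, StrongKernel l t G (f.erase z) := by
  obtain ⟨hfG, hKf, hft⟩ := hf
  have hcov : ∀ X ⊆ f \ K, X.card + 1 < l →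
      ∃ K', StrongKernel l t G K' ∧ X ⊆ K' ∧ K ⊆ K' ∧ K' ⊂ f := by
    intro X hX hXc
    obtain ⟨K', hK', hXK, hKf'⟩ := h.cover f hfG (insert g X)
      (Finset.insert_subset (hKf hgK) (hX.trans Finset.sdiff_subset))
      ((Finset.card_insert_le _ _).trans_lt hXc) ⟨g, by simp [hgR]⟩
    have h1 := hmin _ (hft K' hKf'.1 hK') (Finset.mem_inter.mpr ⟨hXK (by simp), hgK⟩)
      Finset.inter_subset_right
    exact ⟨K', hK', (Finset.subset_insert _ _).trans hXK, h1.trans Finset.inter_subset_left, hKf'⟩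
  have hfc := h.card_eq hfG
  have hca := h.sys.centre_add
  have hsd := Finset.card_sdiff_add_card_eq_card hKf
  have hZ : (f \ K).card + 1 = l := by
    by_contra hne
    obtain ⟨K', -, h1, h2, h3⟩ := hcov (f \ K) subset_rfl (by omega)
    refine h3.2 fun y hy => ?_
    by_cases hyK : y ∈ K
    · exact h2 hyK
    · exact h1 (Finset.mem_sdiff.mpr ⟨hy, hyK⟩)
  refine ⟨hZ, fun z hz => ?_⟩
  obtain ⟨K', h0, h1, h2, h3⟩ := hcov ((f \ K).erase z) (Finset.erase_subset _ _) (by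
    have := Finset.card_erase_add_one hz
    omega)
  have hsub : f.erase z ⊆ K' := by
    intro y hy
    obtain ⟨hyz, hyf⟩ := Finset.mem_erase.mp hy
    by_cases hyK : y ∈ K
    · exact h2 hyK
    · exact h1 (by simp [hyz, hyf, hyK])
  rwa [← eq_erase_of_subset hsub h3]

/-- Otherwise `|K| = l * (t - 1) + 1` by `card_sdiff_minimal`. The next kernel above `K` is `K ∪
{z}` with `z ∈ R`, and a kernel covering the rest of the edge cuts out kernels `D ⊂ K` and `D ∪
{z}`. Rigidity gives `|D| = l * (t - 1)`, so the single vertex of `K \ D` is a body vertex with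
centre `D`, which `hB` excludes. -/
theorem card_minimal_le (h : IsCoveredFamily l t H G R)
    (hB : ∀ e ∈ G, ∀ v ∈ e, ∀ S, ¬ IsBodyVertex l t H S v) {K : Finset V} {g : V}
    (hK : StrongKernel l t G K) (hgR : g ∈ R) (hgK : g ∈ K)
    (hmin : ∀ K', StrongKernel l t G K' → g ∈ K' → K' ⊆ K → K ⊆ K') :
    K.card ≤ l * (t - 1) := by
  by_contra hc
  push Not at hc
  obtain ⟨f, hf⟩ := h.exists_typical hK
  obtain ⟨hZ, -⟩ := h.card_sdiff_minimal hgR hgK hmin hc hf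
  have hl2 : 2 ≤ l := h.sys.two_le.trans h.sys.le_l
  have hKf : K ≠ f := by
    rintro rfl
    simp at hZ
    omega
  obtain ⟨M, ⟨hM, hKM, hMf⟩, hMmin⟩ := exists_minimal_of_wellFoundedLT
    (fun M : Finset V => StrongKernel l t G M ∧ K ⊂ M ∧ M ⊆ f)
    ⟨f, h.strong hf.1, hf.2.1.ssubset_of_ne hKf, subset_rfl⟩
  obtain ⟨f', hf'⟩ := h.exists_typical hM
  -- Kernels in `f'` meet `M` in kernels, which lie in `f` and therefore meet `K` in kernels.
  have hf'K : IsTypical l t G K f' := by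
    refine ⟨hf'.1, hKM.1.trans hf'.2.1, fun K' hK' hs => ?_⟩
    have := hf.2.2 _ (Finset.inter_subset_right.trans hMf) (hf'.2.2 K' hK' hs)
    rwa [Finset.inter_assoc, Finset.inter_eq_right.mpr hKM.1] at this
  obtain ⟨hZ', hers⟩ := h.card_sdiff_minimal hgR hgK hmin hc hf'K
  obtain ⟨z, hzM, hzK⟩ := Finset.exists_of_ssubset hKM
  have hMz : M = insert z K := by
    refine Finset.Subset.antisymm (fun y hy => ?_) (Finset.insert_subset hzM hKM.1)
    by_contra hne
    rw [Finset.mem_insert, not_or] at hne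
    have h1 := hf'.2.2 _ (Finset.erase_subset _ _)
      (hers y (Finset.mem_sdiff.mpr ⟨hf'.2.1 hy, hne.2⟩))
    have h2 : K ⊆ f'.erase y ∩ M := fun a ha =>
      Finset.mem_inter.mpr ⟨Finset.mem_erase.mpr ⟨fun h => hne.2 (h ▸ ha),
        hf'.2.1 (hKM.1 ha)⟩, hKM.1 ha⟩
    have h3 : z ∈ f'.erase y ∩ M :=
      Finset.mem_inter.mpr ⟨Finset.mem_erase.mpr ⟨Ne.symm hne.1, hf'.2.1 hzM⟩, hzM⟩
    have h4 := hMmin ⟨h1, Finset.ssubset_iff_subset_ne.mpr ⟨h2, fun h => hzK (h ▸ h3)⟩,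
      Finset.inter_subset_right.trans hMf⟩ Finset.inter_subset_right hy
    simp at h4
  have hzf' : z ∈ f' \ K := Finset.mem_sdiff.mpr ⟨hf'.2.1 hzM, hzK⟩
  have hzR : z ∈ R := by
    rw [h.mem_R]
    refine ⟨h.sys.isTeamVertex_of_subset (h.weak (h.strong hf'.1)) (h.weak (hers z hzf'))
      (hf'.2.1 hzM) (Finset.notMem_erase _ _) ?_, hB f' hf'.1 z (hf'.2.1 hzM)⟩
    have := Finset.card_erase_add_one (hf'.2.1 hzM)
    have := Finset.card_sdiff_add_card_eq_card (Finset.erase_subset z f')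
    have := h.sys.two_le
    omega
  obtain ⟨K', hK', hXK', hKf'⟩ := h.cover f' hf'.1 (f' \ K) Finset.sdiff_subset (by omega)
    ⟨z, Finset.mem_inter.mpr ⟨hzf', hzR⟩⟩
  have hD := hf'K.2.2 K' hKf'.1 hK'
  have hDz := hf'.2.2 K' hKf'.1 hK'
  rw [hMz, Finset.inter_insert_of_mem (hXK' hzf')] at hDz
  have hb := h.sys.card_kernel (h.weak hDz)
  rw [Finset.card_insert_of_notMem fun hz => hzK (Finset.mem_inter.mp hz).2] at hb
  have hlt := Admissible.lt_of_add h.sys.dvd (h.sys.card_kernel (h.weak hD)) hb one_pos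
    h.sys.two_le
  have hDK : K' ∩ K ≠ K := by
    intro he
    refine hKf'.2 fun y hy => ?_
    by_cases hyK : y ∈ K
    · exact Finset.inter_eq_right.mp he hyK
    · exact hXK' (Finset.mem_sdiff.mpr ⟨hy, hyK⟩)
  have hDlt := Finset.card_lt_card (Finset.inter_subset_right.ssubset_of_ne hDK)
  have hfc := h.card_eq hf'.1
  have hca := h.sys.centre_add
  have hsd := Finset.card_sdiff_add_card_eq_card hf'K.2.1
  obtain ⟨y, hyK, hyD⟩ := Finset.exists_of_ssubset (Finset.inter_subset_right.ssubset_of_ne hDK)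
  have hKy : insert y (K' ∩ K) = K :=
    Finset.eq_of_subset_of_card_le (Finset.insert_subset hyK Finset.inter_subset_right) (by
      rw [Finset.card_insert_of_notMem hyD]; omega)
  exact hB f' hf'.1 y (hf'K.2.1 hyK) (K' ∩ K)
    ⟨h.weak hD, by omega, hyD, by rw [hKy]; exact h.weak hK⟩

end IsCoveredFamily

namespace IsCoveredFamily

variable {l t : ℕ} {H G : Finset (Finset V)} {R : Finset V}

theorem exists_minimal_kernel (_ : IsCoveredFamily l t H G R) {e : Finset V} {g : V}
    (he : StrongKernel l t G e) (hg : g ∈ e) : ∃ K ⊆ e, StrongKernel l t G K ∧ g ∈ K ∧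
      ∀ K', StrongKernel l t G K' → g ∈ K' → K' ⊆ K → K ⊆ K' := by
  obtain ⟨K, hKe, ⟨hK, hgK⟩, hmin⟩ := exists_minimal_le_of_wellFoundedLT
    (fun K : Finset V => StrongKernel l t G K ∧ g ∈ K) e ⟨he, hg⟩
  exact ⟨K, hKe, hK, hgK, fun K' h1 h2 h3 => hmin ⟨h1, h2⟩ h3⟩

/-- A chain of kernels is climbed, with `X` generating `M` among the strong kernels inside `f`; `n`
bounds the remaining height. If the next kernel `M'` adds at least `t` vertices, one of them becomes
a new generator and `(|X| + 1) * t ≤ |M|` persists. If it adds fewer, an added vertex lies in `R`,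
and its minimal kernel, of size at most `l * (t - 1)`, meets `M` and `M'` in sizes that are too
close. At the top `M = f` has fewer than `l` generators, against the covering property. -/
theorem false_of_flag (h : IsCoveredFamily l t H G R)
    (hB : ∀ e ∈ G, ∀ v ∈ e, ∀ S, ¬ IsBodyVertex l t H S v) :
    ∀ (n : ℕ) (M f X : Finset V), l * t ≤ M.card + n → StrongKernel l t G M →
      IsTypical l t G M f → X ⊆ M → (X ∩ R).Nonempty →
      (∀ K' ⊆ f, StrongKernel l t G K' → X ⊆ K' → M ⊆ K') → (X.card + 1) * t ≤ M.card →
      False := by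
  intro n
  induction n with
  | zero =>
    intro M f X hn hM hf hX hXR hgen hcard
    have hMf : M = f := Finset.eq_of_subset_of_card_le hf.2.1 (by rw [h.card_eq hf.1]; omega)
    have hXl : X.card + 1 ≤ l := by
      refine Nat.le_of_mul_le_mul_right (c := t) ?_ (by have := h.sys.two_le; omega)
      rw [← h.card_eq hf.1, ← hMf]
      exact hcard
    obtain ⟨K, hK, hXK, hKf⟩ := h.cover f hf.1 X (hX.trans hf.2.1) hXl hXR
    exact hKf.2 (hMf ▸ hgen K hKf.1 hK hXK)
  | succ n ih =>
    intro M f X hn hM hf hX hXR hgen hcard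
    by_cases hn' : l * t ≤ M.card + n
    · exact ih M f X hn' hM hf hX hXR hgen hcard
    have hMf : M ≠ f := fun he => by
      have := h.card_eq hf.1
      rw [← he] at this
      omega
    obtain ⟨M', ⟨hM', hMM', hM'f⟩, hmin⟩ := exists_minimal_of_wellFoundedLT
      (fun K : Finset V => StrongKernel l t G K ∧ M ⊂ K ∧ K ⊆ f)
      ⟨f, h.strong hf.1, hf.2.1.ssubset_of_ne hMf, subset_rfl⟩
    obtain ⟨f', hf'⟩ := h.exists_typical hM'
    have hdiff := Finset.card_sdiff_add_card_eq_card hMM'.1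
    obtain ⟨x, hxM', hxM⟩ := Finset.exists_of_ssubset hMM'
    by_cases hstep : (M' \ M).card < t
    · have hxR : x ∈ R := (h.mem_R x).mpr ⟨h.sys.isTeamVertex_of_subset (h.weak hM') (h.weak hM)
        hxM' hxM hstep, hB f' hf'.1 x (hf'.2.1 hxM')⟩
      obtain ⟨K, hKf', hK, hxK, hKmin⟩ := h.exists_minimal_kernel (h.strong hf'.1) (hf'.2.1 hxM')
      have hle := h.card_minimal_le hB hK hxR hxK hKmin
      have h1 := hf'.2.2 K hKf' hK
      have h2 := hf.2.2 _ (Finset.inter_subset_right.trans hM'f) h1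
      rw [Finset.inter_assoc, Finset.inter_eq_right.mpr hMM'.1] at h2
      have h3 : ((K ∩ M') \ (K ∩ M)).card + (K ∩ M).card = (K ∩ M').card :=
        Finset.card_sdiff_add_card_eq_card (Finset.inter_subset_inter subset_rfl hMM'.1)
      have h4 : (K ∩ M') \ (K ∩ M) ⊆ M' \ M := by
        intro y hy
        simp only [Finset.mem_sdiff, Finset.mem_inter, not_and] at hy ⊢
        exact ⟨hy.1.2, hy.2 hy.1.1⟩
      have h5 := Finset.card_le_card h4
      have h6 : 0 < ((K ∩ M') \ (K ∩ M)).card := Finset.card_pos.mpr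
        ⟨x, by simp [hxK, hxM', hxM]⟩
      have h7 := Admissible.lt_of_add h.sys.dvd (h.sys.card_kernel (h.weak h2))
        (d := ((K ∩ M') \ (K ∩ M)).card)
        (by rw [add_comm, h3]; exact h.sys.card_kernel (h.weak h1)) h6 (by omega)
      have h8 := Finset.card_le_card (Finset.inter_subset_left : K ∩ M' ⊆ K)
      omega
    · push Not at hstep
      have hMlt := Finset.card_lt_card hMM'
      refine ih M' f' (insert x X) (by omega) hM' hf'
        (Finset.insert_subset hxM' (hX.trans hMM'.1)) ?_ ?_ ?_
      · exact hXR.mono (Finset.inter_subset_inter (Finset.subset_insert _ _) subset_rfl)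
      · intro K hKf' hK hXK
        have h1 := hf'.2.2 K hKf' hK
        have hxK : x ∈ K ∩ M' := Finset.mem_inter.mpr ⟨hXK (by simp), hxM'⟩
        have h2 : M ⊆ K ∩ M' := hgen _ (Finset.inter_subset_right.trans hM'f) h1
          (Finset.subset_inter ((Finset.subset_insert _ _).trans hXK) (hX.trans hMM'.1))
        have h3 : M ⊂ K ∩ M' := Finset.ssubset_iff_subset_ne.mpr ⟨h2, fun he => hxM (he ▸ hxK)⟩
        exact (hmin ⟨h1, h3, Finset.inter_subset_right.trans hM'f⟩
          Finset.inter_subset_right).trans Finset.inter_subset_left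
      · rw [Finset.card_insert_of_notMem fun hx => hxM (hX hx), add_mul _ _ t, one_mul]
        omega

/-- By `hB` and `mem_centre_of_isBodyVertex` no edge of `G` has a body vertex. A minimal kernel at a
vertex of `R` then has size divisible by `t`, but not equal to `t` since the vertex is in no team.
It thus has at least `2 * t` vertices and starts a flag with one generator. -/
theorem eq_empty (h : IsCoveredFamily l t H G R) (hR : ∀ e ∈ G, (e ∩ R).Nonempty)
    (hB : ∀ e ∈ G, ∀ v ∈ e, ∀ S, IsBodyVertex l t H S v → (e \ S ∩ R).Nonempty) : G = ∅ := by
  have hB' : ∀ e ∈ G, ∀ v ∈ e, ∀ S, ¬ IsBodyVertex l t H S v := by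
    intro e he v hv S hS
    obtain ⟨x, hx⟩ := hB e he v hv S hS
    rw [Finset.mem_inter, Finset.mem_sdiff] at hx
    exact hx.1.2 (h.mem_centre_of_isBodyVertex he hx.1.1 hv hS hx.2)
  by_contra hne
  obtain ⟨e, he⟩ := Finset.nonempty_of_ne_empty hne
  obtain ⟨u, hu⟩ := hR e he
  rw [Finset.mem_inter] at hu
  obtain ⟨K, -, hK, huK, hmin⟩ := h.exists_minimal_kernel (h.strong he) hu.1
  obtain ⟨f, hf⟩ := h.exists_typical hK
  have hle := h.card_minimal_le hB' hK hu.2 huK hmin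
  have hdvd : t ∣ K.card := (h.sys.card_kernel (h.weak hK)).elim id fun h1 => by
    rw [le_antisymm hle h1]
    exact h.sys.dvd.mul_right _
  have hpos : 0 < K.card := Finset.card_pos.mpr ⟨u, huK⟩
  have hne : K.card ≠ t := fun hc => ((h.mem_R u).mp hu.2).1 ⟨K, h.weak hK, hc, huK⟩
  refine h.false_of_flag hB' (l * t) K f {u} (by omega) hK hf (by simpa using huK)
    ⟨u, by simp [hu.2]⟩ ?_ ?_
  · intro K' hK'f hK' huK'
    exact (hmin _ (hf.2.2 K' hK'f hK') (Finset.mem_inter.mpr ⟨huK' (by simp), huK⟩)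
      Finset.inter_subset_right).trans Finset.inter_subset_left
  · obtain ⟨s, hs⟩ := hdvd
    have hs0 : s ≠ 0 := by rintro rfl; omega
    have hs1 : s ≠ 1 := by rintro rfl; omega
    rw [Finset.card_singleton, hs, mul_comm t]
    exact Nat.mul_le_mul_right _ (by omega)

end IsCoveredFamily

/-! ### Construction of the decomposition -/

namespace IsAdmissibleSystem

variable {l t : ℕ} {H : Finset (Finset V)}

theorem weak (_ : IsAdmissibleSystem l t H) {e : Finset V} (he : e ∈ H) :
    WeakKernel l t H e := Or.inl he

theorem two_le_l (h : IsAdmissibleSystem l t H) : 2 ≤ l := h.two_le.trans h.le_l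

theorem sdiff_centre_card (h : IsAdmissibleSystem l t H) {e S : Finset V} (he : e ∈ H)
    (hS : S.card = l * (t - 1)) (hSe : S ⊆ e) : (e \ S).card = l := by
  have h1 := Finset.card_sdiff_add_card_eq_card hSe
  have h2 := h.card_eq e he
  have h3 := h.centre_add
  omega

/-- An edge all of whose vertices outside the centre of a body vertex are body vertices meets
the set of all body vertices in `l` vertices. -/
theorem card_inter_body (h : IsAdmissibleSystem l t H) {e S B : Finset V} {v : V} (he : e ∈ H)
    (hB : ∀ w, w ∈ B ↔ ∃ S, IsBodyVertex l t H S w) (hv : v ∈ e) (hS : IsBodyVertex l t H S v)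
    (hsub : e \ S ⊆ B) : (e ∩ B).card = l := by
  have hSe := h.centre_subset hS (h.weak he) hv
  have : e ∩ B = e \ S := by
    ext x
    simp only [Finset.mem_inter, Finset.mem_sdiff]
    refine ⟨fun hx => ⟨hx.1, fun hxS => ?_⟩, fun hx => ⟨hx.1, hsub (by simp [hx])⟩⟩
    obtain ⟨S', hS'⟩ := (hB x).mp hx.2
    exact h.not_mem_centre hS hS' hxS
  rw [this, h.sdiff_centre_card he hS.2.1 hSe]

theorem sdiff_centre_eq (h : IsAdmissibleSystem l t H) {e S B : Finset V} {v : V} (he : e ∈ H)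
    (hB : ∀ w, w ∈ B ↔ ∃ S, IsBodyVertex l t H S w) (hS : IsBodyVertex l t H S v)
    (hSe : S ⊆ e) (hc : (e ∩ B).card = l) : e \ S = e ∩ B := by
  refine (Finset.eq_of_subset_of_card_le (fun x hx => ?_) ?_).symm
  · rw [Finset.mem_inter] at hx
    refine Finset.mem_sdiff.mpr ⟨hx.1, fun hxS => ?_⟩
    obtain ⟨S', hS'⟩ := (hB x).mp hx.2
    exact h.not_mem_centre hS hS' hxS
  · rw [hc, h.sdiff_centre_card he hS.2.1 hSe]

/-- The number of edges that contain a body vertex `v` and a team outside the centre at `v`. -/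
theorem card_mixed_le [Fintype V] (h : IsAdmissibleSystem l t H) {B T : Finset V}
    {A : Finset (Finset V)} (hA : A ⊆ H)
    (hB : ∀ w, w ∈ B ↔ ∃ S, IsBodyVertex l t H S w) (hT : ∀ w, w ∈ T ↔ IsTeamVertex l t H w)
    (hmix : ∀ e ∈ A, ∃ v ∈ e, ∃ S, IsBodyVertex l t H S v ∧ ∃ w ∈ e, w ∉ S ∧ w ∈ T) :
    (A.card : ℝ) ≤ T.card * B.card * (Fintype.card V : ℝ) ^ ((l : ℤ) - 3) := by
  have hB' : ∀ v, ∃ S, v ∈ B → IsBodyVertex l t H S v := fun v => by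
    by_cases hv : v ∈ B
    · obtain ⟨S, hS⟩ := (hB v).mp hv
      exact ⟨S, fun _ => hS⟩
    · exact ⟨∅, fun h => absurd h hv⟩
  have hT' : ∀ w, ∃ W, w ∈ T → WeakKernel l t H W ∧ W.card = t ∧ w ∈ W := fun w => by
    by_cases hw : w ∈ T
    · obtain ⟨W, hW⟩ := (hT w).mp hw
      exact ⟨W, fun _ => hW⟩
    · exact ⟨∅, fun h => absurd h hw⟩
  choose σ hσ using hB'
  choose τ hτ using hT'
  -- Such an edge is determined by `v` with its centre, `w` with its team, and the other `l - 1 - t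
  -- ≤ l - 3` vertices.
  let φ : V × V × Finset V → Finset V := fun q => (insert q.1 (σ q.1) ∪ τ q.2.1) ∪ q.2.2
  have key : ∀ e ∈ A, t + 1 ≤ l ∧
      e ∈ (B ×ˢ T ×ˢ (Finset.univ : Finset V).powersetCard (l - 1 - t)).image φ := by
    intro e he
    obtain ⟨v, hv, S, hS, w, hw, hwS, hwT⟩ := hmix e he
    have hvB : v ∈ B := (hB v).mpr ⟨S, hS⟩
    obtain rfl := h.centre_unique hS (hσ v hvB)
    obtain ⟨hW, hWt, hwW⟩ := hτ w hwT
    have heW := h.weak (hA he)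
    have hWe : τ w ⊆ e := (h.team_inter hW hWt heW).resolve_left fun h0 =>
      Finset.notMem_empty w (h0 ▸ Finset.mem_inter.mpr ⟨hwW, hw⟩)
    have hWS : τ w ∩ σ v = ∅ := (h.team_inter hW hWt hS.1).resolve_right fun h0 => hwS (h0 hwW)
    have hvW : v ∉ τ w := fun hvW => h.not_isTeamVertex hS ⟨_, hW, hWt, hvW⟩
    have hUe : insert v (σ v) ∪ τ w ⊆ e := Finset.union_subset
      (Finset.insert_subset hv (h.centre_subset hS heW hv)) hWe
    have hUc : (insert v (σ v) ∪ τ w).card = l * (t - 1) + 1 + t := by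
      rw [Finset.card_union_of_disjoint, Finset.card_insert_of_notMem hS.2.2.1, hS.2.1, hWt]
      rw [Finset.disjoint_insert_left]
      exact ⟨hvW, Finset.disjoint_iff_inter_eq_empty.mpr (by rwa [Finset.inter_comm])⟩
    have h1 := Finset.card_sdiff_add_card_eq_card hUe
    have h2 := h.card_eq e (hA he)
    have h3 := h.centre_add
    refine ⟨by omega, Finset.mem_image.mpr ⟨(v, w, e \ (insert v (σ v) ∪ τ w)), ?_, ?_⟩⟩
    · simp only [Finset.mem_product, Finset.mem_powersetCard, Finset.subset_univ, true_and]
      exact ⟨hvB, hwT, by omega⟩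
    · exact Finset.union_sdiff_of_subset hUe
  rcases A.eq_empty_or_nonempty with rfl | ⟨e, he⟩
  · simp only [Finset.card_empty, Nat.cast_zero]
    positivity
  obtain ⟨hlt, -⟩ := key e he
  have hpos : 1 ≤ Fintype.card V := by
    obtain ⟨v, -⟩ := hmix e he
    exact Fintype.card_pos_iff.mpr ⟨v⟩
  have hcard : A.card ≤ T.card * B.card * Fintype.card V ^ (l - 3) := by
    refine (Finset.card_le_card fun e he => (key e he).2).trans (Finset.card_image_le.trans ?_)
    rw [Finset.card_product, Finset.card_product, Finset.card_powersetCard, Finset.card_univ,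
      ← mul_assoc, mul_comm B.card]
    refine Nat.mul_le_mul_left _ ((Nat.choose_le_pow _ _).trans (Nat.pow_le_pow_right hpos ?_))
    have := h.two_le
    omega
  have hexp : ((l : ℤ) - 3) = ((l - 3 : ℕ) : ℤ) := by
    have := h.two_le
    omega
  rw [hexp, zpow_natCast]
  exact_mod_cast hcard

/-- The parts of `V` are the team vertices, the body vertices and the rest `R`. The mixed edges `A`
account for the first term of the bound on `HR`. The covered subfamily of `HR \ A` is empty, so
these edges were all deleted, which is the second term. -/
theorem nonempty_decomposition [Fintype V] (h : IsAdmissibleSystem l t H) {a : ℕ}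
    (ha : (l * t).factorial * petals (l * t) (l * t - 1) ^ (l * t) ≤ a) :
    Nonempty (Decomposition t l a H) := by
  classical
  set T : Finset V := Finset.univ.filter fun v => IsTeamVertex l t H v with hTdef
  set B : Finset V := Finset.univ.filter fun v => ∃ S, IsBodyVertex l t H S v with hBdef
  set R : Finset V := (T ∪ B)ᶜ with hRdef
  have hT : ∀ v, v ∈ T ↔ IsTeamVertex l t H v := fun v => by simp [hTdef]
  have hB : ∀ v, v ∈ B ↔ ∃ S, IsBodyVertex l t H S v := fun v => by simp [hBdef]
  have hR : ∀ v, v ∈ R ↔ v ∉ T ∧ v ∉ B := fun v => by simp [hRdef]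
  have hTB : Disjoint T B := Finset.disjoint_left.mpr fun v h1 h2 => by
    obtain ⟨S, hS⟩ := (hB v).mp h2
    exact h.not_isTeamVertex hS ((hT v).mp h1)
  have hl2 := h.two_le_l
  set HT := H.filter fun e => e ⊆ T with hHT
  set HS := H.filter fun e => (e ∩ B).card = l with hHS
  have hTS : Disjoint HT HS := Finset.disjoint_left.mpr fun e h1 h2 => by
    have h3 := (Finset.mem_filter.mp h1).2
    have h4 := (Finset.mem_filter.mp h2).2
    have h5 : e ∩ B = ∅ := Finset.disjoint_iff_inter_eq_empty.mp (hTB.mono_left h3)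
    rw [h5, Finset.card_empty] at h4
    omega
  set HR := H \ (HT ∪ HS) with hHR
  let star : Finset V → Finset (Finset V) := fun S => HS.filter fun e => S ⊆ e
  let centres : Finset (Finset V) :=
    Finset.univ.filter fun S => ∃ v, IsBodyVertex l t H S v
  have hbody : ∀ S, ∀ v ∈ body S (star S), ∀ w, IsBodyVertex l t H S w → IsBodyVertex l t H S v := by
    intro S v hv w hw
    obtain ⟨e, he, hve⟩ := Finset.mem_biUnion.mp hv
    obtain ⟨heS, hSe⟩ := Finset.mem_filter.mp he
    obtain ⟨heH, hec⟩ := Finset.mem_filter.mp heS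
    have heq := h.sdiff_centre_eq heH hB hw hSe hec
    rw [heq] at hve
    obtain ⟨hve', hvB⟩ := Finset.mem_inter.mp hve
    obtain ⟨S', hS'⟩ := (hB v).mp hvB
    have h1 := h.centre_subset hS' (h.weak heH) hve'
    have h2 : S' ⊆ S := by
      intro x hx
      by_contra hxS
      have : x ∈ e ∩ B := heq ▸ Finset.mem_sdiff.mpr ⟨h1 hx, hxS⟩
      obtain ⟨S'', hS''⟩ := (hB x).mp (Finset.mem_inter.mp this).2
      exact h.not_mem_centre hS' hS'' hx
    rwa [← Finset.eq_of_subset_of_card_le h2 (by rw [hw.2.1, hS'.2.1])]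
  set A := HR.filter fun e => ∃ v ∈ e, ∃ S, IsBodyVertex l t H S v ∧ ∃ w ∈ e, w ∉ S ∧ w ∈ T
    with hA
  have hHRH : HR ⊆ H := Finset.sdiff_subset
  have hAle := h.card_mixed_le (A := A) ((Finset.filter_subset _ _).trans hHRH) hB hT
    fun e he => (Finset.mem_filter.mp he).2
  -- Sets of exactly `l - 1` vertices are covered. Kernels properly inside an edge have at most `l *
  -- t - 1` vertices, whence the value of `p`.
  obtain ⟨G, hG, hcov, hGc⟩ := exists_covered_subfamily (j := l - 2)
    (N := petals (l * t)) (p := petals (l * t) (l * t - 1))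
    ((Nat.zero_le _).trans_lt (lt_petals _ _))
    (fun s hs => (Nat.pow_le_pow_right two_pos (Nat.mul_le_mul_left _ (by omega))).trans
      (Nat.le_succ _)) R (HR \ A) (fun e he => h.card_eq e (hHRH (Finset.mem_sdiff.mp he).1))
  have hcovered : IsCoveredFamily l t H G R := by
    refine ⟨h, hG.trans (Finset.sdiff_subset.trans hHRH), fun v => ?_, ?_⟩
    · rw [hR, hT, hB, not_exists]
    · intro e he X hX hXc hXR
      have hec : e.card = l * t := h.card_eq e (hHRH (Finset.mem_sdiff.mp (hG he)).1)
      obtain ⟨Y, hXY, hYe, hYc⟩ := Finset.exists_subsuperset_card_eq (n := l - 2 + 1) hX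
        (by omega) (by
          rw [hec]
          have := Nat.le_mul_of_pos_right l (by have := h.two_le; omega : 0 < t)
          omega)
      obtain ⟨K, hK, hYK, hKe⟩ := hcov e he Y hYe hYc
        (hXR.mono (Finset.inter_subset_inter hXY subset_rfl))
      exact ⟨K, hK, hXY.trans hYK, hKe⟩
  have hGB : ∀ e ∈ G, ∀ v ∈ e, ∀ S, IsBodyVertex l t H S v → (e \ S ∩ R).Nonempty := by
    intro e he v hv S hS
    obtain ⟨heR, heA⟩ := Finset.mem_sdiff.mp (hG he)
    obtain ⟨heH, heTS⟩ := Finset.mem_sdiff.mp heR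
    by_contra hno
    rw [Finset.not_nonempty_iff_eq_empty] at hno
    refine heTS (Finset.mem_union_right _ (Finset.mem_filter.mpr
      ⟨heH, h.card_inter_body heH hB hv hS fun x hx => ?_⟩))
    obtain ⟨hxe, hxS⟩ := Finset.mem_sdiff.mp hx
    by_contra hxB
    by_cases hxT : x ∈ T
    · exact heA (Finset.mem_filter.mpr ⟨heR, v, hv, S, hS, x, hxe, hxS, hxT⟩)
    · exact Finset.notMem_empty x (hno ▸ Finset.mem_inter.mpr ⟨hx, (hR x).mpr ⟨hxT, hxB⟩⟩)
  have hGR : ∀ e ∈ G, (e ∩ R).Nonempty := by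
    intro e he
    by_cases hv : ∃ v ∈ e, v ∈ B
    · obtain ⟨v, hve, hvB⟩ := hv
      obtain ⟨S, hS⟩ := (hB v).mp hvB
      exact (hGB e he v hve S hS).mono (Finset.inter_subset_inter Finset.sdiff_subset subset_rfl)
    · push Not at hv
      obtain ⟨heR, -⟩ := Finset.mem_sdiff.mp (hG he)
      obtain ⟨heH, heTS⟩ := Finset.mem_sdiff.mp heR
      by_contra hno
      rw [Finset.not_nonempty_iff_eq_empty] at hno
      refine heTS (Finset.mem_union_left _ (Finset.mem_filter.mpr ⟨heH, fun x hx => ?_⟩))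
      by_contra hxT
      exact Finset.notMem_empty x
        (hno ▸ Finset.mem_inter.mpr ⟨hx, (hR x).mpr ⟨hxT, hv x hx⟩⟩)
  have hHRle : (HR.card : ℝ) ≤ T.card * B.card * (Fintype.card V : ℝ) ^ ((l : ℤ) - 3) +
      R.card * a * (Fintype.card V : ℝ) ^ ((l : ℤ) - 2) := by
    rw [hcovered.eq_empty hGR hGB, Finset.sdiff_empty] at hGc
    have hexp : ((l : ℤ) - 2) = ((l - 2 : ℕ) : ℤ) := by omega
    have h1 : ((HR \ A).card : ℝ) ≤ R.card * a * (Fintype.card V : ℝ) ^ ((l : ℤ) - 2) := by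
      rw [hexp, zpow_natCast]
      have : (HR \ A).card ≤ R.card * a * Fintype.card V ^ (l - 2) := by
        refine hGc.trans ((Nat.mul_le_mul_left _ ha).trans (le_of_eq (by ring)))
      exact_mod_cast this
    have h2 : (HR.card : ℝ) = A.card + (HR \ A).card := by
      have := Finset.card_sdiff_add_card_eq_card (Finset.filter_subset _ _ : A ⊆ HR)
      rw [← this]
      push_cast
      ring
    rw [h2]
    exact add_le_add hAle h1
  exact ⟨{
    VT := T
    VS := B
    VR := R
    disjoint_VT_VS := hTB
    disjoint_VT_VR := disjoint_compl_right.mono_left Finset.subset_union_left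
    disjoint_VS_VR := disjoint_compl_right.mono_left Finset.subset_union_right
    union_V := Finset.union_compl _
    HT := HT
    HS := HS
    HR := HR
    disjoint_HT_HS := hTS
    disjoint_HT_HR := Finset.disjoint_sdiff.mono_left Finset.subset_union_left
    disjoint_HS_HR := Finset.disjoint_sdiff.mono_left Finset.subset_union_right
    union_H := Finset.union_sdiff_of_subset
      (Finset.union_subset (Finset.filter_subset _ _) (Finset.filter_subset _ _))
    teams := by
      refine ⟨Finset.univ.filter fun W => WeakKernel l t H W ∧ W.card = t, ?_, ?_, ?_⟩
      · intro W hW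
        obtain ⟨-, h1, h2⟩ := Finset.mem_filter.mp hW
        exact ⟨h2, fun e he => (h.team_inter h1 h2 (h.weak he)).imp id Finset.inter_eq_left.mpr⟩
      · intro W hW W' hW' hne
        obtain ⟨-, h1, h2⟩ := Finset.mem_filter.mp hW
        obtain ⟨-, h1', h2'⟩ := Finset.mem_filter.mp hW'
        exact Finset.disjoint_iff_inter_eq_empty.mpr ((h.team_inter h1 h2 h1').resolve_right
          fun hs => hne (Finset.eq_of_subset_of_card_le hs (by rw [h2, h2'])))
      · ext v
        simp [hT, IsTeamVertex, and_assoc]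
    HT_eq := rfl
    HS_eq := rfl
    centres := centres
    star := star
    HS_eq_stars := by
      ext e
      simp only [Finset.mem_biUnion]
      refine ⟨fun he => ?_, fun ⟨S, _, he⟩ => (Finset.mem_filter.mp he).1⟩
      obtain ⟨heH, hec⟩ := Finset.mem_filter.mp he
      obtain ⟨v, hv⟩ := Finset.card_pos.mp (by omega : 0 < (e ∩ B).card)
      obtain ⟨hve, hvB⟩ := Finset.mem_inter.mp hv
      obtain ⟨S, hS⟩ := (hB v).mp hvB
      exact ⟨S, Finset.mem_filter.mpr ⟨Finset.mem_univ _, v, hS⟩,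
        Finset.mem_filter.mpr ⟨he, h.centre_subset hS (h.weak heH) hve⟩⟩
    isStar := by
      intro S hS
      obtain ⟨-, v, hv⟩ := Finset.mem_filter.mp hS
      exact ⟨hv.2.1, fun e he => (Finset.mem_filter.mp he).2⟩
    centre_subset := by
      intro S hS x hx
      obtain ⟨-, v, hv⟩ := Finset.mem_filter.mp hS
      have hxB : x ∉ B := fun hxB => by
        obtain ⟨S', hS'⟩ := (hB x).mp hxB
        exact h.not_mem_centre hv hS' hx
      by_cases hxT : x ∈ T
      · exact Finset.mem_union_left _ hxT
      · exact Finset.mem_union_right _ ((hR x).mpr ⟨hxT, hxB⟩)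
    body_subset := by
      intro S hS x hx
      obtain ⟨-, v, hv⟩ := Finset.mem_filter.mp hS
      exact (hB x).mpr ⟨S, hbody S x hx v hv⟩
    bodies_disjoint := by
      intro S hS S' hS' hne
      obtain ⟨-, v, hv⟩ := Finset.mem_filter.mp hS
      obtain ⟨-, v', hv'⟩ := Finset.mem_filter.mp hS'
      exact Finset.disjoint_left.mpr fun x hx hx' =>
        hne (h.centre_unique (hbody S x hx v hv) (hbody S' x hx' v' hv'))
    centre_subset_of_meets_body := by
      rintro S hS e he ⟨x, hx⟩
      obtain ⟨-, v, hv⟩ := Finset.mem_filter.mp hS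
      obtain ⟨hxe, hxb⟩ := Finset.mem_inter.mp hx
      exact h.centre_subset (hbody S x hxb v hv) (h.weak he) hxe
    card_HR_le := hHRle }⟩

end IsAdmissibleSystem

/-- With `k = r * t ^ 2` the right-hand side is the constant of the theorem, as `k ^ 3 = r ^ 3 * t ^
6`. -/
theorem factorial_mul_petals_le {k : ℕ} (hk : 4 ≤ k) :
    k.factorial * petals k (k - 1) ^ k ≤ k ^ (k ^ 3) := by
  have h1 : petals k (k - 1) ^ k = 2 ^ (k ^ 3 + k ^ 2) := by
    rw [petals, Nat.sub_add_cancel (by omega), ← pow_mul]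
    ring_nf
  have h2 : k ≤ k ^ 3 := Nat.le_self_pow (by norm_num) k
  have h3 : k ^ 3 + k ^ 2 ≤ 2 * (k ^ 3 - k) := by
    zify [h2]
    have : (4 : ℤ) ≤ k := by exact_mod_cast hk
    nlinarith [mul_nonneg (by positivity : (0 : ℤ) ≤ k) (by nlinarith : (0 : ℤ) ≤ k ^ 2 - k - 2)]
  calc k.factorial * petals k (k - 1) ^ k ≤ k ^ k * 2 ^ (2 * (k ^ 3 - k)) := by
        rw [h1]
        exact Nat.mul_le_mul k.factorial_le_pow (Nat.pow_le_pow_right two_pos h3)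
    _ = k ^ k * 4 ^ (k ^ 3 - k) := by rw [pow_mul]; norm_num
    _ ≤ k ^ k * k ^ (k ^ 3 - k) := Nat.mul_le_mul_left _ (Nat.pow_le_pow_left hk _)
    _ = k ^ (k ^ 3) := by rw [← pow_add, Nat.add_sub_cancel' h2]

theorem InJ.isAdmissibleSystem {r t : ℕ} {H : Finset (Finset V)} (hr : 1 ≤ r) (ht : 2 ≤ t)
    (h : InJ r t H) : IsAdmissibleSystem (r * t) t H :=
  ⟨ht, Nat.mul_pos hr (by omega), Dvd.intro_left r rfl,
    fun e he => (h.1 e he).trans (by ring), h.2⟩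

theorem InJ.inF [Fintype V] {r t : ℕ} {H : Finset (Finset V)} (hr : 1 ≤ r) (ht : 2 ≤ t)
    (h : InJ r t H) : InF t (r * t) ((r * t ^ 2) ^ (r ^ 3 * t ^ 6)) H := by
  have hs := h.isAdmissibleSystem hr ht
  refine ⟨hs.card_eq, hs.nonempty_decomposition ?_⟩
  have h1 : r * t ^ 2 = r * t * t := by ring
  have h2 : r ^ 3 * t ^ 6 = (r * t * t) ^ 3 := by ring
  rw [h1, h2]
  exact factorial_mul_petals_le (by nlinarith [Nat.mul_le_mul hr (Nat.mul_le_mul ht ht)])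

/-! ### Unions of teams, and edge counts of decompositions -/

theorem biUnion_filter_eq {t : ℕ} {H P : Finset (Finset V)}
    (hP : ∀ W ∈ P, W.card = t ∧ Inseparable H W) {e : Finset V}
    (he : e ∈ H) (heP : e ⊆ P.biUnion id) : (P.filter fun W => W ⊆ e).biUnion id = e := by
  ext x
  simp only [Finset.mem_biUnion, Finset.mem_filter, id]
  refine ⟨fun ⟨W, ⟨_, hWe⟩, hx⟩ => hWe hx, fun hx => ?_⟩
  obtain ⟨W, hW, hxW⟩ := Finset.mem_biUnion.mp (heP hx)
  refine ⟨W, ⟨hW, ?_⟩, hxW⟩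
  rcases (hP W hW).2 e he with h | h
  · exact absurd (Finset.mem_inter.mpr ⟨hxW, hx⟩) (h ▸ Finset.notMem_empty x)
  · exact Finset.inter_eq_left.mp h

theorem card_biUnion_teams {t : ℕ} {P : Finset (Finset V)} (hP : ∀ W ∈ P, W.card = t)
    (hd : ∀ W ∈ P, ∀ W' ∈ P, W ≠ W' → Disjoint W W') : (P.biUnion id).card = P.card * t := by
  exact (Finset.card_biUnion hd).trans (Finset.sum_const_nat hP)

theorem card_filter_subset {l t : ℕ} (ht : 0 < t) {H P : Finset (Finset V)}
    (hH : ∀ e ∈ H, e.card = l * t)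
    (hP : ∀ W ∈ P, W.card = t ∧ Inseparable H W)
    (hd : ∀ W ∈ P, ∀ W' ∈ P, W ≠ W' → Disjoint W W') {e : Finset V}
    (he : e ∈ H) (heP : e ⊆ P.biUnion id) : (P.filter fun W => W ⊆ e).card = l := by
  have h1 := card_biUnion_teams (P := P.filter fun W => W ⊆ e)
    (fun W hW => (hP W (Finset.mem_filter.mp hW).1).1)
    (fun W hW W' hW' => hd W (Finset.mem_filter.mp hW).1 W' (Finset.mem_filter.mp hW').1)
  rw [biUnion_filter_eq hP he heP, hH e he] at h1
  exact (Nat.eq_of_mul_eq_mul_right ht h1).symm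

/-- Edges inside a disjoint union of inseparable `t`-sets are unions of `l` of them. -/
theorem subset_image_powersetCard {l t : ℕ} (ht : 0 < t) {H P : Finset (Finset V)}
    (hH : ∀ e ∈ H, e.card = l * t)
    (hP : ∀ W ∈ P, W.card = t ∧ Inseparable H W)
    (hd : ∀ W ∈ P, ∀ W' ∈ P, W ≠ W' → Disjoint W W') :
    (H.filter fun e => e ⊆ P.biUnion id) ⊆ (P.powersetCard l).image fun Q => Q.biUnion id := by
  intro e he
  obtain ⟨heH, heP⟩ := Finset.mem_filter.mp he
  refine Finset.mem_image.mpr ⟨P.filter fun W => W ⊆ e, ?_, biUnion_filter_eq hP heH heP⟩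
  rw [Finset.mem_powersetCard]
  exact ⟨Finset.filter_subset _ _, card_filter_subset ht hH hP hd heH heP⟩

/-- If fewer than `t` vertices lie outside a disjoint union of inseparable `t`-sets, then every
edge lies inside. -/
theorem subset_of_card_lt [Fintype V] {l t : ℕ} {H P : Finset (Finset V)}
    (hH : ∀ e ∈ H, e.card = l * t)
    (hP : ∀ W ∈ P, W.card = t ∧ Inseparable H W)
    (hd : ∀ W ∈ P, ∀ W' ∈ P, W ≠ W' → Disjoint W W')
    (hc : Fintype.card V < P.card * t + t) {e : Finset V} (he : e ∈ H) : e ⊆ P.biUnion id := by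
  have h1 : (e ∩ P.biUnion id) = (P.filter fun W => W ⊆ e).biUnion id := by
    ext x
    simp only [Finset.mem_inter, Finset.mem_biUnion, Finset.mem_filter, id]
    constructor
    · rintro ⟨hx, W, hW, hxW⟩
      refine ⟨W, ⟨hW, ?_⟩, hxW⟩
      rcases (hP W hW).2 e he with h | h
      · exact absurd (Finset.mem_inter.mpr ⟨hxW, hx⟩) (h ▸ Finset.notMem_empty x)
      · exact Finset.inter_eq_left.mp h
    · rintro ⟨W, ⟨hW, hWe⟩, hxW⟩
      exact ⟨hWe hxW, W, hW, hxW⟩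
  -- Both the edge and its part inside the teams have size divisible by `t`, so the part outside
  -- does too; it is smaller than `t`, hence empty.
  have h2 : t ∣ (e ∩ P.biUnion id).card := by
    rw [h1, card_biUnion_teams (fun W hW => (hP W (Finset.mem_filter.mp hW).1).1)
      (fun W hW W' hW' => hd W (Finset.mem_filter.mp hW).1 W' (Finset.mem_filter.mp hW').1)]
    exact Dvd.intro_left _ rfl
  have h3 : t ∣ (e \ P.biUnion id).card := by
    rw [← Nat.dvd_add_right h2, Finset.card_inter_add_card_sdiff, hH e he]
    exact Dvd.intro_left _ rfl
  have h4 : (e \ P.biUnion id).card < t := by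
    have h5 : e \ P.biUnion id ⊆ (P.biUnion id)ᶜ := fun x hx => by
      rw [Finset.mem_compl]; exact (Finset.mem_sdiff.mp hx).2
    have h6 := Finset.card_le_card h5
    rw [Finset.card_compl, card_biUnion_teams (fun W hW => (hP W hW).1) hd] at h6
    have : 0 < t := by
      by_contra h0
      have h7 := Finset.card_le_univ (P.biUnion id)
      rw [card_biUnion_teams (fun W hW => (hP W hW).1) hd] at h7
      omega
    omega
  exact Finset.sdiff_eq_empty_iff_subset.mp
    (Finset.card_eq_zero.mp (Nat.eq_zero_of_dvd_of_lt h3 h4))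

/-- The number of edges of a star in terms of the size of its body. -/
theorem IsStar.card_le {l s : ℕ} {S : Finset V} {E : Finset (Finset V)} (h : IsStar s S E)
    (hE : ∀ e ∈ E, e.card = s + l) : E.card ≤ (body S E).card.choose l := by
  rw [← Finset.card_powersetCard]
  refine Finset.card_le_card_of_injOn (fun e => e \ S) ?_ ?_
  · intro e he
    refine Finset.mem_coe.mpr (Finset.mem_powersetCard.mpr ⟨?_, ?_⟩)
    · exact Finset.subset_biUnion_of_mem (fun e => e \ S) he
    · have h1 := Finset.card_sdiff_add_card_eq_card (h.2 e he)
      have h2 := hE e he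
      have h3 := h.1
      change (e \ S).card = l
      omega
  · intro e he f hf hef
    rw [← Finset.sdiff_union_of_subset (h.2 e he), ← Finset.sdiff_union_of_subset (h.2 f hf)]
    exact congrArg (· ∪ S) hef

namespace Decomposition

variable [Fintype V] {t l a : ℕ} {H : Finset (Finset V)}

theorem card_V (D : Decomposition t l a H) :
    D.VT.card + D.VS.card + D.VR.card = Fintype.card V := by
  have h : Disjoint (D.VT ∪ D.VS) D.VR :=
    Finset.disjoint_union_left.mpr ⟨D.disjoint_VT_VR, D.disjoint_VS_VR⟩
  rw [← Finset.card_union_of_disjoint D.disjoint_VT_VS, ← Finset.card_union_of_disjoint h,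
    D.union_V, Finset.card_univ]

theorem card_H (D : Decomposition t l a H) :
    D.HT.card + D.HS.card + D.HR.card = H.card := by
  have h : Disjoint (D.HT ∪ D.HS) D.HR :=
    Finset.disjoint_union_left.mpr ⟨D.disjoint_HT_HR, D.disjoint_HS_HR⟩
  rw [← Finset.card_union_of_disjoint D.disjoint_HT_HS, ← Finset.card_union_of_disjoint h,
    D.union_H]

theorem star_subset (D : Decomposition t l a H) {S : Finset V} (hS : S ∈ D.centres) :
    D.star S ⊆ H := by
  intro e he
  rw [← D.union_H, D.HS_eq_stars]
  exact Finset.mem_union_left _ (Finset.mem_union_right _ (Finset.mem_biUnion.mpr ⟨S, hS, he⟩))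

theorem sum_body_le (D : Decomposition t l a H) :
    ∑ S ∈ D.centres, (body S (D.star S)).card ≤ D.VS.card := by
  rw [← Finset.card_biUnion D.bodies_disjoint]
  exact Finset.card_le_card (Finset.biUnion_subset.mpr D.body_subset)

theorem card_HS_le (D : Decomposition t l a H) :
    D.HS.card ≤ ∑ S ∈ D.centres, (D.star S).card := by
  rw [D.HS_eq_stars]
  exact Finset.card_biUnion_le

theorem card_star_le (D : Decomposition t l a H) (ht : 1 ≤ t) (hH : ∀ e ∈ H, e.card = l * t)
    {S : Finset V} (hS : S ∈ D.centres) :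
    (D.star S).card ≤ (body S (D.star S)).card.choose l := by
  refine (D.isStar S hS).card_le fun e he => ?_
  rw [hH e (D.star_subset hS he)]
  obtain ⟨s, rfl⟩ : ∃ s, t = s + 1 := ⟨t - 1, by omega⟩
  simp [Nat.mul_succ]

theorem card_HS_le_pow (D : Decomposition t l a H) (ht : 1 ≤ t) (hl : 1 ≤ l)
    (hH : ∀ e ∈ H, e.card = l * t) : D.HS.card ≤ D.VS.card ^ l := by
  obtain ⟨i, rfl⟩ : ∃ i, l = i + 1 := ⟨l - 1, by omega⟩
  calc D.HS.card ≤ ∑ S ∈ D.centres, (body S (D.star S)).card * D.VS.card ^ i := by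
        refine D.card_HS_le.trans (Finset.sum_le_sum fun S hS => ?_)
        refine (D.card_star_le ht hH hS).trans ((Nat.choose_le_pow _ _).trans ?_)
        rw [pow_succ, mul_comm]
        exact Nat.mul_le_mul_left _ (Nat.pow_le_pow_left
          (Finset.card_le_card (D.body_subset S hS)) _)
    _ ≤ D.VS.card * D.VS.card ^ i := by
        rw [← Finset.sum_mul]
        exact Nat.mul_le_mul_right _ D.sum_body_le
    _ = D.VS.card ^ (i + 1) := by rw [pow_succ, mul_comm]

theorem card_HS_le_mul (D : Decomposition t l a H) {lam : ℝ} (hlam : 0 ≤ lam)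
    (h : ∀ S ∈ D.centres, ((D.star S).card : ℝ) ≤ (body S (D.star S)).card * lam) :
    (D.HS.card : ℝ) ≤ D.VS.card * lam := by
  calc (D.HS.card : ℝ) ≤ ∑ S ∈ D.centres, ((D.star S).card : ℝ) := by
        exact_mod_cast D.card_HS_le
    _ ≤ ∑ S ∈ D.centres, ((body S (D.star S)).card : ℝ) * lam := Finset.sum_le_sum h
    _ ≤ D.VS.card * lam := by
        rw [← Finset.sum_mul]
        exact mul_le_mul_of_nonneg_right (by exact_mod_cast D.sum_body_le) hlam

end Decomposition

/-- An edge through `v` contains the team of `v` and is determined by its `l - 1` other teams. -/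
theorem card_filter_mem_le [Fintype V] {l t : ℕ} (ht : 0 < t) {H P : Finset (Finset V)}
    (hH : ∀ e ∈ H, e.card = l * t)
    (hP : ∀ W ∈ P, W.card = t ∧ Inseparable H W)
    (hd : ∀ W ∈ P, ∀ W' ∈ P, W ≠ W' → Disjoint W W')
    (hsub : ∀ e ∈ H, e ⊆ P.biUnion id) (v : V) :
    (H.filter fun e => v ∈ e).card ≤ (P.card - 1).choose (l - 1) := by
  by_cases hv : ∃ W ∈ P, v ∈ W
  · obtain ⟨W, hW, hvW⟩ := hv
    rw [← Finset.card_erase_of_mem hW, ← Finset.card_powersetCard]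
    have hWe : ∀ e ∈ H, v ∈ e → W ∈ P.filter fun W => W ⊆ e := by
      intro e he hve
      refine Finset.mem_filter.mpr ⟨hW, ?_⟩
      rcases (hP W hW).2 e he with h | h
      · exact absurd (Finset.mem_inter.mpr ⟨hvW, hve⟩) (h ▸ Finset.notMem_empty v)
      · exact Finset.inter_eq_left.mp h
    refine Finset.card_le_card_of_injOn (fun e => (P.filter fun W => W ⊆ e).erase W) ?_ ?_
    · intro e he
      obtain ⟨heH, hve⟩ := Finset.mem_filter.mp he
      refine Finset.mem_coe.mpr (Finset.mem_powersetCard.mpr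
        ⟨Finset.erase_subset_erase _ (Finset.filter_subset _ _), ?_⟩)
      rw [Finset.card_erase_of_mem (hWe e heH hve),
        card_filter_subset ht hH hP hd heH (hsub e heH)]
    · intro e he f hf hef
      obtain ⟨heH, hve⟩ := Finset.mem_filter.mp he
      obtain ⟨hfH, hvf⟩ := Finset.mem_filter.mp hf
      have h1 : (P.filter fun W => W ⊆ e) = P.filter fun W => W ⊆ f := by
        rw [← Finset.insert_erase (hWe e heH hve), ← Finset.insert_erase (hWe f hfH hvf)]
        exact congrArg _ hef
      rw [← biUnion_filter_eq hP heH (hsub e heH), ← biUnion_filter_eq hP hfH (hsub f hfH), h1]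
  · have : (H.filter fun e => v ∈ e) = ∅ := by
      refine Finset.filter_eq_empty_iff.mpr fun e he hve => hv ?_
      obtain ⟨W, hW, hvW⟩ := Finset.mem_biUnion.mp (hsub e he hve)
      exact ⟨W, hW, hvW⟩
    simp [this]

/-! ### Numerical estimates, with `l = j + 2` -/

/-- Bernoulli's inequality in homogeneous form. -/
theorem sub_mul_pow_le_sub_pow {x c : ℝ} (hc : 0 ≤ c) (hx : c ≤ x) (j : ℕ) :
    x ^ (j + 1) - (j + 1) * c * x ^ j ≤ (x - c) ^ (j + 1) := by
  have hx0 : 0 ≤ x := hc.trans hx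
  induction j with
  | zero => simp
  | succ j ih =>
    have h1 := mul_le_mul_of_nonneg_left ih (sub_nonneg.mpr hx)
    have h2 : 0 ≤ (j + 1) * c * c * x ^ j := by positivity
    calc x ^ (j + 1 + 1) - ((j + 1 : ℕ) + 1) * c * x ^ (j + 1)
        ≤ (x - c) * (x ^ (j + 1) - (j + 1) * c * x ^ j) := by
          push_cast
          rw [pow_succ x (j + 1), pow_succ x j] at *
          nlinarith [h2]
      _ ≤ (x - c) * (x - c) ^ (j + 1) := h1
      _ = _ := by ring

theorem sub_pow_div_le_choose {x : ℝ} {q k : ℕ} (hx : x ≤ q + 1) (hk : k ≤ x) :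
    (x - k) ^ k / k.factorial ≤ q.choose k := by
  refine le_trans ?_ (Nat.pow_le_choose (α := ℝ) k q)
  have h1 : x - k ≤ ((q + 1 - k : ℕ) : ℝ) := by
    have : k ≤ q + 1 := by exact_mod_cast hk.trans hx
    rw [Nat.cast_sub this]
    push_cast
    linarith
  exact div_le_div_of_nonneg_right (pow_le_pow_left₀ (sub_nonneg.mpr hk) h1 _) (by positivity)

theorem choose_add_mul_choose_le (τ d i : ℕ) :
    τ.choose (i + 1) + d * τ.choose i ≤ (τ + d).choose (i + 1) := by
  induction d with
  | zero => simp
  | succ d ih =>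
    rw [← add_assoc, Nat.choose_succ_succ]
    have : τ.choose i ≤ (τ + d).choose i := Nat.choose_le_choose _ (by omega)
    nlinarith

theorem div_lt_floor_add_one {n t : ℕ} (ht : 0 < t) : (n : ℝ) / t < (n / t : ℕ) + 1 := by
  rw [div_lt_iff₀ (by exact_mod_cast ht)]
  have := Nat.lt_div_mul_add ht (a := n)
  have h2 : n < (n / t + 1) * t := by rw [add_mul, one_mul]; exact this
  exact_mod_cast h2

/-- A lower bound for the number of edges in terms of the number of vertices. -/
theorem edges_lower {n t j : ℕ} {m : ℝ} (ht : 1 ≤ t) (hn : t * (j + 2) ≤ n)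
    (hm : ((n / t).choose (j + 2) : ℝ) -
      (n : ℝ) ^ (j + 1) / (2 * (t : ℝ) ^ (j + 1) * ((j + 1).factorial : ℝ)) ≤ m) :
    (n : ℝ) ^ (j + 2) / ((t : ℝ) ^ (j + 2) * ((j + 2).factorial : ℝ)) -
      ((j + 2 : ℝ) ^ 2 + 1) * (n : ℝ) ^ (j + 1) ≤ m := by
  refine le_trans ?_ hm
  have ht0 : (1 : ℝ) ≤ t := by exact_mod_cast ht
  have htpos : (0 : ℝ) < t := by linarith
  have hx : ((j + 2 : ℕ) : ℝ) ≤ (n : ℝ) / t := by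
    rw [le_div_iff₀ htpos]
    exact_mod_cast (by linarith : (j + 2) * t ≤ n)
  have h1 := sub_pow_div_le_choose (div_lt_floor_add_one (by omega : 0 < t)).le hx
  have h2 := sub_mul_pow_le_sub_pow (by positivity : (0 : ℝ) ≤ ((j + 2 : ℕ) : ℝ)) hx (j + 1)
  have hfac : (1 : ℝ) ≤ ((j + 2).factorial : ℝ) := by exact_mod_cast Nat.factorial_pos _
  have hfac' : (1 : ℝ) ≤ ((j + 1).factorial : ℝ) := by exact_mod_cast Nat.factorial_pos _
  have h3 := div_le_div_of_nonneg_right h2 (by positivity : (0 : ℝ) ≤ ((j + 2).factorial : ℝ))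
  have h4 : ((n : ℝ) / t) ^ (j + 1) ≤ (n : ℝ) ^ (j + 1) :=
    pow_le_pow_left₀ (by positivity) (div_le_self (by positivity) ht0) _
  have h5 : (n : ℝ) ^ (j + 1) / (2 * (t : ℝ) ^ (j + 1) * ((j + 1).factorial : ℝ)) ≤
      (n : ℝ) ^ (j + 1) := by
    refine div_le_self (by positivity) ?_
    have : (1 : ℝ) ≤ (t : ℝ) ^ (j + 1) := one_le_pow₀ ht0
    nlinarith [mul_le_mul this hfac' (by positivity) (by positivity)]
  have h6 : (((j + 1 : ℕ) : ℝ) + 1) * ((j + 2 : ℕ) : ℝ) * ((n : ℝ) / t) ^ (j + 1) /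
      ((j + 2).factorial : ℝ) ≤ (j + 2 : ℝ) ^ 2 * (n : ℝ) ^ (j + 1) := by
    refine (div_le_self (by positivity) hfac).trans ?_
    push_cast
    calc ((j : ℝ) + 1 + 1) * (j + 2) * ((n : ℝ) / t) ^ (j + 1)
        = (j + 2 : ℝ) ^ 2 * ((n : ℝ) / t) ^ (j + 1) := by ring
      _ ≤ _ := mul_le_mul_of_nonneg_left h4 (by positivity)
  have h7 : ((n : ℝ) / t) ^ (j + 1 + 1) / ((j + 2).factorial : ℝ) =
      (n : ℝ) ^ (j + 2) / ((t : ℝ) ^ (j + 2) * ((j + 2).factorial : ℝ)) := by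
    rw [div_pow, div_div]
  rw [sub_div, h7] at h3
  linarith

/-- The bound of `edges_lower` for the average number `m / n` of edges per vertex. -/
theorem average_lower {n t j : ℕ} {m : ℝ} (ht : 1 ≤ t) (hn : t * (j + 2) ≤ n)
    (hm : ((n / t).choose (j + 2) : ℝ) -
      (n : ℝ) ^ (j + 1) / (2 * (t : ℝ) ^ (j + 1) * ((j + 1).factorial : ℝ)) ≤ m) :
    (n : ℝ) ^ j * ((n : ℝ) / ((t : ℝ) ^ (j + 2) * ((j + 2).factorial : ℝ)) -
      ((j + 2 : ℝ) ^ 2 + 1)) ≤ m / n := by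
  have hn0 : (0 : ℝ) < n := by
    have : 0 < n := lt_of_lt_of_le (by positivity) hn
    exact_mod_cast this
  rw [le_div_iff₀ hn0]
  refine le_trans (le_of_eq ?_) (edges_lower ht hn hm)
  ring

theorem choose_le_mul_pow_div (b j : ℕ) :
    (b.choose (j + 2) : ℝ) ≤ b * ((b : ℝ) ^ (j + 1) / ((j + 2).factorial : ℝ)) := by
  refine (Nat.choose_le_pow_div (α := ℝ) (j + 2) b).trans (le_of_eq ?_)
  ring

/-- The numerical core of the extremal argument, for few teams. -/
theorem no_few_teams {n t j a τ nS nR : ℕ} {A ε N e μ : ℝ} (ht : 1 ≤ t)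
    (hA : A = (t : ℝ) ^ (j + 2) * ((j + 2).factorial : ℝ)) (hε0 : 0 < ε) (hε1 : ε ≤ 1)
    (hn0 : (0 : ℝ) < n) (hN : N = (n : ℝ) ^ j) (he : n * e = N) (he0 : 0 ≤ e)
    (hsum : τ * t + nS + nR = n)
    (hμ : N * ((n : ℝ) / A - ((j + 2 : ℝ) ^ 2 + 1)) ≤ μ) (hμa : a * N < μ)
    (hbig : A * ((j + 2 : ℝ) ^ 2 + 1) < ε * n)
    (hmain : n * μ ≤ (τ.choose (j + 2) : ℝ) + nS * (μ - N) + (τ * t * nS * e + nR * a * N))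
    (hτ : (τ : ℝ) ≤ (1 - ε) * (n / t)) : False := by
  have htpos : (0 : ℝ) < t := by exact_mod_cast ht
  have hNpos : 0 < N := hN ▸ by positivity
  have hfac : (0 : ℝ) < ((j + 2).factorial : ℝ) := by exact_mod_cast Nat.factorial_pos _
  have hApos : 0 < A := hA ▸ by positivity
  have hs : (τ : ℝ) * t + nS + nR = n := by exact_mod_cast hsum
  have h1 : (τ : ℝ) * t * e ≤ N := by
    rw [← he]
    refine mul_le_mul_of_nonneg_right ?_ he0
    have : (0 : ℝ) ≤ nS := by positivity
    have : (0 : ℝ) ≤ nR := by positivity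
    linarith
  -- Split `n` into `τ * t + nS + nR`. A vertex of `V_S` accounts for at most `μ - N + τ * t * e ≤
  -- μ` edges and one of `V_R` for at most `a * N < μ`, so the teams must supply their full share `τ
  -- * t * μ`, which `τ.choose l` cannot when `τ` is small.
  have h2 : τ * t * μ + nR * (μ - a * N) + nS * (N - τ * t * e) ≤ (τ.choose (j + 2) : ℝ) := by
    rw [← hs] at hmain
    nlinarith
  have h3 : 0 ≤ (nR : ℝ) * (μ - a * N) := mul_nonneg (by positivity) (by linarith)
  have h4 : 0 ≤ (nS : ℝ) * (N - τ * t * e) := mul_nonneg (by positivity) (by linarith)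
  rcases Nat.eq_zero_or_pos τ with h0 | hτpos
  · subst h0
    simp only [Nat.cast_zero, zero_mul, zero_add, sub_zero, Nat.choose_zero_succ] at h2 h4 hs
    have h5 : (nS : ℝ) * N = 0 := by linarith
    have h6 : (nR : ℝ) * (μ - a * N) = 0 := by linarith
    have h7 : (nS : ℝ) = 0 := (mul_eq_zero.mp h5).resolve_right hNpos.ne'
    have h8 : (nR : ℝ) = 0 := (mul_eq_zero.mp h6).resolve_right (by linarith)
    linarith
  · have hτ0 : (0 : ℝ) < τ := by exact_mod_cast hτpos
    have h5 : (τ : ℝ) * (t * μ) ≤ τ * ((τ : ℝ) ^ (j + 1) / ((j + 2).factorial : ℝ)) :=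
      le_trans (by linarith) (choose_le_mul_pow_div τ j)
    have h6 := le_of_mul_le_mul_left h5 hτ0
    have h7 : (τ : ℝ) ^ (j + 1) ≤ (1 - ε) * (n / t) ^ (j + 1) := by
      refine (pow_le_pow_left₀ hτ0.le hτ _).trans ?_
      rw [mul_pow]
      refine mul_le_mul_of_nonneg_right ?_ (by positivity)
      exact pow_le_of_le_one (by linarith) (by linarith) (by omega)
    have h8 : ((n : ℝ) / t) ^ (j + 1) / ((j + 2).factorial : ℝ) = t * N * (n / A) := by
      rw [hA, hN, div_pow]
      field_simp
      try ring
    have h9 : t * μ ≤ (1 - ε) * (t * N * (n / A)) := by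
      rw [← h8, ← mul_div_assoc]
      exact h6.trans (div_le_div_of_nonneg_right h7 hfac.le)
    have h10 : t * N * (n / A - ((j + 2 : ℝ) ^ 2 + 1)) ≤ t * N * ((1 - ε) * (n / A)) := by
      calc t * N * (n / A - ((j + 2 : ℝ) ^ 2 + 1)) ≤ t * μ := by
            rw [mul_assoc]; exact mul_le_mul_of_nonneg_left hμ htpos.le
        _ ≤ _ := h9
        _ = _ := by ring
    have h11 := le_of_mul_le_mul_left h10 (by positivity)
    have h12 : ε * n / A ≤ (j + 2 : ℝ) ^ 2 + 1 := by
      rw [mul_div_assoc]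
      linarith
    rw [div_le_iff₀ hApos] at h12
    linarith

/-- The numerical core of the extremal argument, for many teams. -/
theorem no_many_teams {n t j a τ nS nR d : ℕ} {A N m : ℝ} (ht : 1 ≤ t) (ha : 1 ≤ a)
    (hA : A = (t : ℝ) ^ (j + 2) * ((j + 2).factorial : ℝ))
    (hn0 : (0 : ℝ) < n) (hN : N = (n : ℝ) ^ j)
    (hsum : τ * t + nS + nR = n) (hd : 1 ≤ d) (hq : τ + d = n / t)
    (hbig : 8 * A * ((j + 1) * j + 2 * t * a) < n) (hbig' : 2 * t * (j + 1) ≤ (n : ℝ))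
    (hm : ((n / t).choose (j + 2) : ℝ) -
      (n : ℝ) ^ (j + 1) / (2 * (t : ℝ) ^ (j + 1) * ((j + 1).factorial : ℝ)) ≤ m)
    (hmain : m ≤ (τ.choose (j + 2) : ℝ) + (nS : ℝ) ^ (j + 2) + (nS * N + nR * a * N))
    (hτ : (1 - 1 / (16 * A)) * (n / t) < τ) : False := by
  have ht1 : (1 : ℝ) ≤ t := by exact_mod_cast ht
  have htpos : (0 : ℝ) < t := by linarith
  have hNpos : 0 < N := hN ▸ by positivity
  have hfac : (1 : ℝ) ≤ ((j + 1).factorial : ℝ) := by exact_mod_cast Nat.factorial_pos _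
  have hA' : A = t * (j + 2) * ((t : ℝ) ^ (j + 1) * ((j + 1).factorial : ℝ)) := by
    rw [hA, Nat.factorial_succ (j + 1)]
    push_cast
    ring
  have hj : (0 : ℝ) ≤ j := by positivity
  have hD : 1 ≤ (t : ℝ) ^ (j + 1) * ((j + 1).factorial : ℝ) :=
    one_le_mul_of_one_le_of_one_le (one_le_pow₀ ht1) hfac
  have hAge : t * (j + 2 : ℝ) ≤ A := by
    rw [hA']; exact le_mul_of_one_le_right (by positivity) hD
  have hAj : (j + 2 : ℝ) ≤ A := le_trans (le_mul_of_one_le_left (by positivity) ht1) hAge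
  have hApos : 0 < A := by linarith
  set ε : ℝ := 1 / (16 * A) with hεdef
  have hεA : 16 * ε * A = 1 := by rw [hεdef]; field_simp
  have hε0 : 0 < ε := by positivity
  have hεj : 16 * ε * (j + 2) ≤ 1 := by
    rw [← hεA]; exact mul_le_mul_of_nonneg_left hAj (by positivity)
  have hε32 : 32 * ε ≤ 1 := by
    have h0 := mul_le_mul_of_nonneg_left (by linarith : 2 ≤ A) (by positivity : 0 ≤ 16 * ε)
    linarith
  have hε1 : ε ≤ 1 := by linarith
  set x : ℝ := n / t with hx
  have hxpos : 0 < x := by positivity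
  have hxt : x * t = n := by rw [hx]; field_simp
  have hxn : x ≤ n := div_le_self hn0.le ht1
  set Y : ℝ := x ^ (j + 1) / ((j + 1).factorial : ℝ) with hY
  have hYeq : Y * A = N * n * (t * (j + 2)) := by
    rw [hY, hA', hx, hN, div_pow]
    field_simp
    try ring
  have hYhalf : (n : ℝ) ^ (j + 1) / (2 * (t : ℝ) ^ (j + 1) * ((j + 1).factorial : ℝ)) = Y / 2 := by
    rw [hY, hx, div_pow]
    field_simp
  have hYpos : 0 < Y := by positivity
  have hxj : 2 * (j + 1 : ℝ) ≤ x := by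
    rw [hx, le_div_iff₀ htpos]; linarith
  have hεx := mul_le_mul_of_nonneg_right hε32 hxpos.le
  have hc1 : ε * x + j ≤ x := by linarith
  have hτj : ((j + 1 : ℕ) : ℝ) ≤ (τ : ℝ) + 1 := by push_cast; linarith
  have hC : Y - (j + 1) * ε * Y - (j + 1) * j * N ≤ (τ.choose (j + 1) : ℝ) := by
    have h1 := sub_pow_div_le_choose (x := (τ : ℝ) + 1) (q := τ) le_rfl hτj
    have h2 := sub_mul_pow_le_sub_pow (by positivity : 0 ≤ ε * x + j) hc1 j
    have h3 : (x - (ε * x + j)) ^ (j + 1) ≤ ((τ : ℝ) + 1 - ((j + 1 : ℕ) : ℝ)) ^ (j + 1) := by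
      refine pow_le_pow_left₀ (by linarith) ?_ _
      push_cast
      linarith
    have h4 := div_le_div_of_nonneg_right (h2.trans h3)
      (by positivity : (0 : ℝ) ≤ ((j + 1).factorial : ℝ))
    refine le_trans ?_ (h4.trans h1)
    have h5 : (j + 1 : ℝ) * j * x ^ j / ((j + 1).factorial : ℝ) ≤ (j + 1) * j * N := by
      refine (div_le_self (by positivity) hfac).trans ?_
      rw [hN]
      exact mul_le_mul_of_nonneg_left (pow_le_pow_left₀ hxpos.le hxn _) (by positivity)
    have h6 : (x ^ (j + 1) - (j + 1) * (ε * x + j) * x ^ j) / ((j + 1).factorial : ℝ) =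
        Y - (j + 1) * ε * Y - (j + 1) * j * x ^ j / ((j + 1).factorial : ℝ) := by
      rw [hY]
      ring
    rw [h6]
    linarith
  have hs : (τ : ℝ) * t + nS + nR = n := by exact_mod_cast hsum
  have hd1 : (1 : ℝ) ≤ d := by exact_mod_cast hd
  have hnS0 : (0 : ℝ) ≤ nS := by positivity
  have hnR0 : (0 : ℝ) ≤ nR := by positivity
  -- From `n < (τ + d + 1) * t` there are fewer than `(d + 1) * t` vertices outside the teams.
  have hrest : (nS : ℝ) + nR ≤ 2 * t * d := by
    have h1 := div_lt_floor_add_one (n := n) (by omega : 0 < t)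
    rw [← hq, ← hx] at h1
    push_cast at h1
    have h2 := mul_le_mul_of_nonneg_right h1.le htpos.le
    have h3 := mul_le_mul_of_nonneg_right hd1 htpos.le
    rw [hxt] at h2
    linarith
  have hSε : (nS : ℝ) ≤ ε * n := by
    have h1 := mul_le_mul_of_nonneg_right hτ.le htpos.le
    rw [mul_assoc, hxt] at h1
    linarith
  have hSpow : (nS : ℝ) ^ (j + 2) ≤ 2 * t * d * (ε * (N * n)) := by
    have h1 : (nS : ℝ) ^ (j + 1) ≤ ε * (N * n) := by
      refine (pow_le_pow_left₀ hnS0 hSε _).trans ?_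
      rw [mul_pow, hN, ← pow_succ]
      exact mul_le_mul_of_nonneg_right (pow_le_of_le_one hε0.le hε1 (by omega)) (by positivity)
    rw [pow_succ, mul_comm]
    exact mul_le_mul (by linarith) h1 (by positivity) (by positivity)
  have hRN : (nS : ℝ) * N + nR * a * N ≤ 2 * t * d * a * N := by
    have ha1 : (1 : ℝ) ≤ a := by exact_mod_cast ha
    have h1 : (nS : ℝ) + nR * a ≤ 2 * t * d * a :=
      calc (nS : ℝ) + nR * a ≤ (nS + nR) * a := by
            rw [add_mul]
            exact add_le_add_left (le_mul_of_one_le_right hnS0 ha1) _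
        _ ≤ _ := mul_le_mul_of_nonneg_right hrest (by positivity)
    calc (nS : ℝ) * N + nR * a * N = (nS + nR * a) * N := by ring
      _ ≤ _ := mul_le_mul_of_nonneg_right h1 hNpos.le
  have hchoose : (τ.choose (j + 2) : ℝ) + d * (τ.choose (j + 1) : ℝ) ≤
      ((n / t).choose (j + 2) : ℝ) := by
    rw [← hq]
    exact_mod_cast choose_add_mul_choose_le τ d (j + 1)
  -- The `d` missing teams cost at least `d * τ.choose (j + 1)` edges, and the vertices outside
  -- return only a small multiple of `d * Y`. The hypothesis tolerates a deficit of `Y / 2`, whereas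
  -- `τ.choose (j + 1)` is nearly `Y`.
  have hfin : d * ((τ.choose (j + 1) : ℝ) - 2 * t * (ε * (N * n)) - 2 * t * a * N) ≤ Y / 2 := by
    rw [hYhalf] at hm
    have h1 : d * ((τ.choose (j + 1) : ℝ) - 2 * t * (ε * (N * n)) - 2 * t * a * N) =
        d * (τ.choose (j + 1) : ℝ) - 2 * t * d * (ε * (N * n)) - 2 * t * d * a * N := by ring
    linarith
  have h1 : 16 * (2 * t * (ε * (N * n))) ≤ Y := by
    have : 2 * t * (ε * (N * n)) * 16 * (j + 2) = 2 * Y := by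
      have h2 : ε * (N * n * (t * (j + 2))) * 16 = Y := by
        rw [← hYeq]
        linear_combination Y * hεA
      linear_combination 2 * h2
    have h3 : 0 ≤ 2 * t * (ε * (N * n)) * j := by positivity
    linarith
  have h2 : 16 * ((j + 1) * ε * Y) ≤ Y := by
    have h0 : 16 * ε * (j + 1) ≤ 1 := by linarith
    calc 16 * ((j + 1) * ε * Y) = 16 * ε * (j + 1) * Y := by ring
      _ ≤ 1 * Y := mul_le_mul_of_nonneg_right h0 hYpos.le
      _ = Y := one_mul Y
  have h3 : 8 * ((j + 1) * j + 2 * t * a) * N < Y := by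
    have h4 : N * n ≤ Y * A := by
      rw [hYeq]
      exact le_mul_of_one_le_right (by positivity)
        (one_le_mul_of_one_le_of_one_le ht1 (by linarith))
    have h5 : 8 * ((j + 1) * j + 2 * t * a) * N * A < Y * A := by
      refine lt_of_lt_of_le ?_ h4
      have h6 := mul_lt_mul_of_pos_left hbig hNpos
      linarith
    exact lt_of_mul_lt_mul_right h5 hApos.le
  have h4 : Y / 2 < (τ.choose (j + 1) : ℝ) - 2 * t * (ε * (N * n)) - 2 * t * a * N := by
    linarith
  have h5 := mul_le_mul_of_nonneg_right hd1 ((half_pos hYpos).trans h4).le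
  linarith

/-! ### Small stars force a full set of teams -/

/-- The lower bounds on the number `n` of vertices under which the estimates below hold. -/
structure IsLarge (t j a n : ℕ) : Prop where
  one_le : 1 ≤ n
  few : 16 * (t ^ (j + 2) * (j + 2).factorial) *
    (t ^ (j + 2) * (j + 2).factorial * ((j + 2) ^ 2 + 1)) < n
  many : 8 * (t ^ (j + 2) * (j + 2).factorial) * ((j + 1) * j + 2 * t * a) < n
  linear : 2 * t * (j + 2) ≤ n
  rest : t ^ (j + 2) * (j + 2).factorial * (a + ((j + 2) ^ 2 + 1)) < n
  edges : t ^ (j + 2) * (j + 2).factorial * (15 * t + ((j + 2) ^ 2 + 1)) < n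
  body : 5 * (t ^ (j + 2) * (j + 2).factorial) * ((j + 2) ^ 2 + 2) ≤ n
  const : 10 * t * (3 * (j + 2)) ^ (3 * (j + 2)) < n

theorem exists_forall_isLarge (t j a : ℕ) : ∃ n₀, ∀ n, n₀ ≤ n → IsLarge t j a n := by
  refine ⟨1 + (16 * (t ^ (j + 2) * (j + 2).factorial) *
    (t ^ (j + 2) * (j + 2).factorial * ((j + 2) ^ 2 + 1)) + 1) +
    (8 * (t ^ (j + 2) * (j + 2).factorial) * ((j + 1) * j + 2 * t * a) + 1) +
    2 * t * (j + 2) + (t ^ (j + 2) * (j + 2).factorial * (a + ((j + 2) ^ 2 + 1)) + 1) +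
    (t ^ (j + 2) * (j + 2).factorial * (15 * t + ((j + 2) ^ 2 + 1)) + 1) +
    5 * (t ^ (j + 2) * (j + 2).factorial) * ((j + 2) ^ 2 + 2) +
    (10 * t * (3 * (j + 2)) ^ (3 * (j + 2)) + 1), fun n hn => ?_⟩
  constructor <;> omega

theorem IsLarge.average_gt {t j a n : ℕ} {m : ℝ} (hL : IsLarge t j a n) (ht : 1 ≤ t)
    (hm : ((n / t).choose (j + 2) : ℝ) -
      (n : ℝ) ^ (j + 1) / (2 * (t : ℝ) ^ (j + 1) * ((j + 1).factorial : ℝ)) ≤ m) {c : ℕ}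
    (hc : t ^ (j + 2) * (j + 2).factorial * (c + ((j + 2) ^ 2 + 1)) < n) :
    c * (n : ℝ) ^ j < m / n := by
  have hlin : t * (j + 2) ≤ n := by have := hL.linear; linarith
  refine lt_of_lt_of_le ?_ (average_lower ht hlin hm)
  have hn0 : (0 : ℝ) < n := by exact_mod_cast hL.one_le
  have htpos : (0 : ℝ) < t := by exact_mod_cast ht
  have hA : (0 : ℝ) < (t : ℝ) ^ (j + 2) * ((j + 2).factorial : ℝ) := by positivity
  have h1 : ((t : ℝ) ^ (j + 2) * ((j + 2).factorial : ℝ)) * (c + ((j + 2 : ℝ) ^ 2 + 1)) < n := by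
    exact_mod_cast hc
  have h2 : (c : ℝ) + ((j + 2 : ℝ) ^ 2 + 1) < n / ((t : ℝ) ^ (j + 2) * ((j + 2).factorial : ℝ)) := by
    rw [lt_div_iff₀ hA]; linarith
  rw [mul_comm]
  exact mul_lt_mul_of_pos_left (by linarith) (by positivity)

/-- If all stars of a decomposition are small then the teams cover all but fewer than `t`
vertices, and all edges are unions of teams. -/
theorem Decomposition.exists_teams [Fintype V] {t j a n : ℕ} {H : Finset (Finset V)}
    (D : Decomposition t (j + 2) a H) (ht : 1 ≤ t) (ha : 1 ≤ a)
    (hH : ∀ e ∈ H, e.card = (j + 2) * t) (hn : Fintype.card V = n) (hL : IsLarge t j a n)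
    (hm : ((n / t).choose (j + 2) : ℝ) -
      (n : ℝ) ^ (j + 1) / (2 * (t : ℝ) ^ (j + 1) * ((j + 1).factorial : ℝ)) ≤ H.card)
    (hstar : ∀ S ∈ D.centres, ((D.star S).card : ℝ) ≤
      (body S (D.star S)).card * (H.card / n - (n : ℝ) ^ j)) :
    ∃ P : Finset (Finset V), (∀ W ∈ P, W.card = t ∧ Inseparable H W) ∧
      (∀ W ∈ P, ∀ W' ∈ P, W ≠ W' → Disjoint W W') ∧ P.card = n / t ∧
      ∀ e ∈ H, e ⊆ P.biUnion id := by
  obtain ⟨P, hP, hd, hPV⟩ := D.teams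
  have hPt : ∀ W ∈ P, W.card = t := fun W hW => (hP W hW).1
  have hVT : D.VT.card = P.card * t := by rw [hPV]; exact card_biUnion_teams hPt hd
  have hsum : P.card * t + D.VS.card + D.VR.card = n := by rw [← hVT, ← hn]; exact D.card_V
  have hlin : t * (j + 2) ≤ n := by have := hL.linear; linarith
  have hn0 : (0 : ℝ) < n := by exact_mod_cast hL.one_le
  have htpos : (0 : ℝ) < t := by exact_mod_cast ht
  have hPle : P.card ≤ n / t := by
    rw [Nat.le_div_iff_mul_le (by omega)]
    omega
  suffices hPge : n / t ≤ P.card by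
    have hPeq := le_antisymm hPle hPge
    refine ⟨P, hP, hd, hPeq, fun e he => subset_of_card_lt hH hP hd ?_ he⟩
    rw [hn, hPeq]
    exact Nat.lt_div_mul_add (by omega)
  by_contra hlt
  push Not at hlt
  set A : ℝ := (t : ℝ) ^ (j + 2) * ((j + 2).factorial : ℝ) with hA
  have hApos : 0 < A := by positivity
  have hA1 : 1 ≤ A := by
    refine one_le_mul_of_one_le_of_one_le (one_le_pow₀ (by exact_mod_cast ht)) ?_
    exact_mod_cast Nat.factorial_pos _
  have hμa : a * (n : ℝ) ^ j < H.card / n := hL.average_gt ht hm hL.rest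
  have hNμ : (n : ℝ) ^ j < H.card / n := by
    refine lt_of_le_of_lt ?_ hμa
    exact le_mul_of_one_le_left (by positivity) (by exact_mod_cast ha)
  have hHT : D.HT.card ≤ P.card.choose (j + 2) := by
    rw [D.HT_eq, hPV, ← Finset.card_powersetCard]
    exact (Finset.card_le_card (subset_image_powersetCard (by omega) hH hP hd)).trans
      Finset.card_image_le
  have hHS := D.card_HS_le_mul (sub_nonneg.mpr hNμ.le) hstar
  have hHS' := D.card_HS_le_pow ht (by omega) hH
  -- For `j = 0` this exponent is `-1`; the relation `n * e = n ^ j` holds in every case.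
  set e : ℝ := (n : ℝ) ^ (((j + 2 : ℕ) : ℤ) - 3) with he
  have hne : n * e = (n : ℝ) ^ j := by
    rw [he, ← zpow_one_add₀ hn0.ne', ← zpow_natCast]
    congr 1
    push_cast
    ring
  have hHR : (D.HR.card : ℝ) ≤ P.card * t * D.VS.card * e + D.VR.card * a * (n : ℝ) ^ j := by
    refine D.card_HR_le.trans (le_of_eq ?_)
    have h1 : (n : ℝ) ^ (((j + 2 : ℕ) : ℤ) - 2) = (n : ℝ) ^ j := by
      rw [← zpow_natCast]
      congr 1
      push_cast
      ring
    rw [hVT, hn, h1]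
    push_cast
    rfl
  have he0 : 0 ≤ e := by positivity
  have hcard : (D.HT.card : ℝ) + D.HS.card + D.HR.card = H.card := by exact_mod_cast D.card_H
  have hHT' : (D.HT.card : ℝ) ≤ (P.card.choose (j + 2) : ℝ) := by exact_mod_cast hHT
  rcases le_or_gt (P.card : ℝ) ((1 - 1 / (16 * A)) * (n / t)) with hfew | hmany
  · refine no_few_teams (ε := 1 / (16 * A)) ht hA (by positivity)
      ((div_le_one (by positivity)).mpr (by linarith)) hn0 rfl hne he0 hsum
      (average_lower ht hlin hm) hμa ?_ ?_ hfew
    · have h1 : 16 * A * (A * ((j + 2 : ℝ) ^ 2 + 1)) < n := by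
        rw [hA]
        exact_mod_cast hL.few
      rw [one_div, inv_mul_eq_div, lt_div_iff₀ (by positivity)]
      linarith
    · rw [mul_div_cancel₀ _ hn0.ne']
      linarith
  · obtain ⟨d, hd'⟩ := Nat.exists_eq_add_of_lt hlt
    have hVT_le : (P.card : ℝ) * t ≤ n := by
      have : P.card * t ≤ n := by omega
      exact_mod_cast this
    refine no_many_teams (d := d + 1) (m := H.card) ht ha hA hn0 rfl hsum (by omega)
      (by omega) ?_ ?_ hm ?_ hmany
    · rw [hA]
      exact_mod_cast hL.many
    · have := hL.linear
      have h1 : 2 * t * (j + 1) ≤ n := by nlinarith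
      exact_mod_cast h1
    · have h1 : (D.HS.card : ℝ) ≤ (D.VS.card : ℝ) ^ (j + 2) := by exact_mod_cast hHS'
      have h2 : (P.card : ℝ) * t * D.VS.card * e ≤ D.VS.card * (n : ℝ) ^ j := by
        rw [← hne]
        calc (P.card : ℝ) * t * D.VS.card * e = P.card * t * (D.VS.card * e) := by ring
          _ ≤ n * (D.VS.card * e) := mul_le_mul_of_nonneg_right hVT_le (by positivity)
          _ = _ := by ring
      linarith

/-! ### The large star -/

/-- The lower bound for the size of the body of the large star. -/
theorem body_lower {n t j b : ℕ} {s μ : ℝ} (htl : t ≤ j + 2) (ht : 1 ≤ t)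
    (hs0 : 0 < s) (hs : s ^ (j + 1) = (t : ℝ) ^ (j + 2)) (hs2 : s ≤ 2 * t) (hn0 : (0 : ℝ) < n)
    (hμ : (n : ℝ) ^ j * ((n : ℝ) / ((t : ℝ) ^ (j + 2) * ((j + 2).factorial : ℝ)) -
      ((j + 2 : ℝ) ^ 2 + 1)) ≤ μ)
    (hb : (j + 2 : ℝ) * (μ - (n : ℝ) ^ j) ≤ ((b - 1).choose (j + 1) : ℝ)) :
    n / s - (3 * (j + 2 : ℝ)) ^ (3 * (j + 2)) ≤ b := by
  set x : ℝ := n / s with hx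
  set c : ℝ := (3 * (j + 2 : ℝ)) ^ (3 * (j + 2)) with hc
  have hxpos : 0 < x := by positivity
  have htpos : (0 : ℝ) < t := by exact_mod_cast ht
  have hc0 : 0 < c := by positivity
  have hxs : x * s = n := by rw [hx]; field_simp
  by_contra hlt
  push Not at hlt
  -- If `b < x - c`, then `b ^ (j + 1) ≤ x ^ (j + 1) - c * x ^ j`. The leading terms on both sides
  -- of `hb` agree because `s ^ (j + 1) = t ^ (j + 2)`, so `c` is at most `l! * (l ^ 2 + 2) * s ^
  -- j`, which is less than `(3 * l) ^ (3 * l)`.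
  have h1 : ((b - 1).choose (j + 1) : ℝ) * ((j + 1).factorial : ℝ) ≤ (b : ℝ) ^ (j + 1) := by
    have h2 := Nat.choose_le_pow_div (α := ℝ) (j + 1) (b - 1)
    rw [le_div_iff₀ (by positivity)] at h2
    refine h2.trans (pow_le_pow_left₀ (by positivity) ?_ _)
    exact_mod_cast Nat.sub_le b 1
  have h2 : (b : ℝ) ^ (j + 1) ≤ x ^ (j + 1) - c * x ^ j := by
    calc (b : ℝ) ^ (j + 1) ≤ (x - c) ^ (j + 1) := pow_le_pow_left₀ (by positivity) hlt.le _
      _ = (x - c) ^ j * (x - c) := pow_succ _ _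
      _ ≤ x ^ j * (x - c) := by
        have hb0 : (0 : ℝ) ≤ b := by positivity
        exact mul_le_mul_of_nonneg_right (pow_le_pow_left₀ (by linarith) (by linarith) _)
          (by linarith)
      _ = _ := by ring
  have hfac : ((j + 2).factorial : ℝ) = (j + 2) * ((j + 1).factorial : ℝ) := by
    rw [Nat.factorial_succ]
    push_cast
    ring
  have hfacpos : (0 : ℝ) < ((j + 2).factorial : ℝ) := by positivity
  have h3 : ((j + 2).factorial : ℝ) * (μ - (n : ℝ) ^ j) ≤ x ^ (j + 1) - c * x ^ j := by
    rw [hfac]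
    have := mul_le_mul_of_nonneg_right hb (by positivity : (0 : ℝ) ≤ ((j + 1).factorial : ℝ))
    linarith
  have h4 : ((j + 2).factorial : ℝ) * ((n : ℝ) ^ j *
      ((n : ℝ) / ((t : ℝ) ^ (j + 2) * ((j + 2).factorial : ℝ)))) = x ^ (j + 1) := by
    rw [hx, div_pow, hs]
    field_simp
    ring
  have h5 := mul_le_mul_of_nonneg_left hμ hfacpos.le
  have h6 : c * x ^ j ≤ ((j + 2).factorial : ℝ) * ((j + 2 : ℝ) ^ 2 + 2) * (n : ℝ) ^ j := by
    linarith
  have h7 : (n : ℝ) ^ j = x ^ j * s ^ j := by rw [← hxs, mul_pow]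
  rw [h7] at h6
  have h8 : c ≤ ((j + 2).factorial : ℝ) * ((j + 2 : ℝ) ^ 2 + 2) * s ^ j :=
    le_of_mul_le_mul_right (by linarith) (by positivity : 0 < x ^ j)
  have hl0 : (0 : ℝ) < j + 2 := by positivity
  have h9 : s ^ j ≤ (3 * (j + 2 : ℝ)) ^ j := by
    refine pow_le_pow_left₀ hs0.le (hs2.trans ?_) _
    have : (t : ℝ) ≤ j + 2 := by exact_mod_cast htl
    linarith
  have h10 : ((j + 2).factorial : ℝ) ≤ (3 * (j + 2 : ℝ)) ^ (j + 2) := by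
    have h := Nat.factorial_le_pow (j + 2)
    have h' : ((j + 2).factorial : ℝ) ≤ (j + 2 : ℝ) ^ (j + 2) := by exact_mod_cast h
    exact h'.trans (pow_le_pow_left₀ hl0.le (by linarith) _)
  have h11 : (j + 2 : ℝ) ^ 2 + 2 < (3 * (j + 2 : ℝ)) ^ 2 := by nlinarith
  have h12 : ((j + 2).factorial : ℝ) * ((j + 2 : ℝ) ^ 2 + 2) * s ^ j <
      (3 * (j + 2 : ℝ)) ^ (j + 2) * (3 * (j + 2 : ℝ)) ^ 2 * (3 * (j + 2 : ℝ)) ^ j := by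
    refine mul_lt_mul ?_ h9 (by positivity) (by positivity)
    exact mul_lt_mul' h10 h11 (by positivity) (by positivity)
  have h13 : (3 * (j + 2 : ℝ)) ^ (j + 2) * (3 * (j + 2 : ℝ)) ^ 2 * (3 * (j + 2 : ℝ)) ^ j ≤ c := by
    rw [← pow_add, ← pow_add, hc]
    exact pow_le_pow_right₀ (by linarith) (by omega)
  linarith

theorem exists_isLeast_choose (c : ℝ) (i : ℕ) :
    ∃ N, IsLeast {N : ℕ | 1 ≤ N ∧ c ≤ ((N - 1).choose (i + 1) : ℝ)} N := by
  have hne : {N : ℕ | 1 ≤ N ∧ c ≤ ((N - 1).choose (i + 1) : ℝ)}.Nonempty := by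
    refine ⟨i + ⌈c⌉₊ + 1, by omega, (Nat.le_ceil c).trans ?_⟩
    have h := choose_add_mul_choose_le i ⌈c⌉₊ i
    simp only [Nat.choose_succ_self, Nat.choose_self, mul_one, zero_add] at h
    simpa using h
  exact ⟨sInf _, Nat.sInf_mem hne, fun _ h => Nat.sInf_le h⟩

theorem rpow_div_pow {t j : ℕ} :
    ((t : ℝ) ^ ((j + 2 : ℝ) / (j + 1))) ^ (j + 1) = (t : ℝ) ^ (j + 2) := by
  rw [← Real.rpow_natCast, ← Real.rpow_mul (by positivity), ← Real.rpow_natCast]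
  congr 1
  push_cast
  field_simp

/-- After taking `(j + 1)`-th powers this is `t ≤ 2 ^ (j + 1)`. -/
theorem rpow_div_le {t j : ℕ} (htl : t ≤ j + 2) :
    (t : ℝ) ^ ((j + 2 : ℝ) / (j + 1)) ≤ 2 * t := by
  refine le_of_pow_le_pow_left₀ (Nat.succ_ne_zero j) (by positivity) ?_
  rw [rpow_div_pow, mul_pow, pow_succ, mul_comm]
  refine mul_le_mul_of_nonneg_right ?_ (by positivity)
  have h1 : t ≤ 2 ^ (j + 1) := htl.trans (Nat.lt_two_pow_self (n := j + 1))
  exact_mod_cast h1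

/-- Were there no such star, all stars would have at most `b * (m / n - n ^ j)` edges, where `b` is
the size of the body, and `Decomposition.exists_teams` would contradict `hm`. For `b ≥ nhat` this
uses `b ≤ n`. For `b < nhat` it follows from `l * b.choose l = b * (b - 1).choose (l - 1)` and the
minimality of `nhat`. -/
theorem exists_large_star [Fintype V] {t j a n : ℕ} {H : Finset (Finset V)} (ht : 1 ≤ t)
    (ha : 1 ≤ a) (htl : t ≤ j + 2) (hH : ∀ e ∈ H, e.card = (j + 2) * t)
    (hn : Fintype.card V = n) (hL : IsLarge t j a n)
    (hm : (n / t).choose (j + 2) + 1 ≤ H.card) :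
    ∃ nhat : ℕ,
      IsLeast {N : ℕ | 1 ≤ N ∧ (j + 2 : ℝ) * H.card / n - (j + 2) * (n : ℝ) ^ j ≤
        ((N - 1).choose (j + 1) : ℝ)} nhat ∧
      (n / (t : ℝ) ^ ((j + 2 : ℝ) / (j + 1)) - (3 * (j + 2 : ℝ)) ^ (3 * (j + 2)) : ℝ) ≤ nhat ∧
      (2 * n / (5 * t) : ℝ) <
        n / (t : ℝ) ^ ((j + 2 : ℝ) / (j + 1)) - (3 * (j + 2 : ℝ)) ^ (3 * (j + 2)) ∧
      (H.card / (3 * t) : ℝ) < H.card * nhat / n - (n : ℝ) ^ (j + 1) ∧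
      ∀ D : Decomposition t (j + 2) a H, ∃ S ∈ D.centres, nhat ≤ (body S (D.star S)).card ∧
        (H.card * nhat / n - (n : ℝ) ^ (j + 1) : ℝ) ≤ (D.star S).card := by
  have htpos : (0 : ℝ) < t := by exact_mod_cast ht
  have hn0 : (0 : ℝ) < n := by exact_mod_cast hL.one_le
  have hm' : ((n / t).choose (j + 2) : ℝ) -
      (n : ℝ) ^ (j + 1) / (2 * (t : ℝ) ^ (j + 1) * ((j + 1).factorial : ℝ)) ≤ H.card := by
    have h1 : ((n / t).choose (j + 2) : ℝ) + 1 ≤ H.card := by exact_mod_cast hm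
    have h2 : 0 ≤ (n : ℝ) ^ (j + 1) / (2 * (t : ℝ) ^ (j + 1) * ((j + 1).factorial : ℝ)) := by
      positivity
    linarith
  have hlin : t * (j + 2) ≤ n := by have := hL.linear; linarith
  set s : ℝ := (t : ℝ) ^ ((j + 2 : ℝ) / (j + 1)) with hs
  have hs0 : 0 < s := Real.rpow_pos_of_pos htpos _
  have hs2 : s ≤ 2 * t := rpow_div_le htl
  set μ : ℝ := H.card / n with hμ
  have hμn : μ * n = H.card := by rw [hμ]; field_simp
  obtain ⟨nhat, hleast⟩ := exists_isLeast_choose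
    ((j + 2 : ℝ) * H.card / n - (j + 2) * (n : ℝ) ^ j) j
  have hset : (j + 2 : ℝ) * H.card / n - (j + 2) * (n : ℝ) ^ j =
      (j + 2) * (μ - (n : ℝ) ^ j) := by rw [hμ]; ring
  have hlow := body_lower htl ht hs0 rpow_div_pow hs2 hn0 (average_lower ht hlin hm')
    (hset ▸ hleast.1.2)
  have hconst : (2 * n / (5 * t) : ℝ) < n / s - (3 * (j + 2 : ℝ)) ^ (3 * (j + 2)) := by
    have h1 : (n : ℝ) / (2 * t) ≤ n / s := div_le_div_of_nonneg_left hn0.le hs0 hs2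
    have h2 : 10 * (t : ℝ) * (3 * (j + 2 : ℝ)) ^ (3 * (j + 2)) < n := by exact_mod_cast hL.const
    have h3 : (3 * (j + 2 : ℝ)) ^ (3 * (j + 2)) < n / (10 * t) := by
      rw [lt_div_iff₀ (by positivity)]; linarith
    have h4 : (n : ℝ) / (2 * t) - 2 * n / (5 * t) = n / (10 * t) := by
      field_simp
      norm_num
    linarith
  have hedge : (15 * t : ℝ) * (n : ℝ) ^ j < μ := by
    have h1 := hL.average_gt (c := 15 * t) ht hm' hL.edges
    push_cast at h1
    exact h1
  have hNμ : (n : ℝ) ^ j ≤ μ := by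
    refine le_trans (le_mul_of_one_le_left (by positivity) ?_) hedge.le
    have : (1 : ℝ) ≤ t := by exact_mod_cast ht
    linarith
  have hpow : (n : ℝ) ^ (j + 1) = (n : ℝ) ^ j * n := pow_succ _ _
  have hμ0 : 0 < μ := lt_of_lt_of_le (by positivity) hNμ
  refine ⟨nhat, hleast, hlow, hconst, ?_, fun D => ?_⟩
  · have h1 : (2 * n / (5 * t) : ℝ) < nhat := hconst.trans_le hlow
    have h2 : μ * (2 * n / (5 * t)) < μ * nhat := mul_lt_mul_of_pos_left h1 hμ0
    have h3 : (H.card : ℝ) * nhat / n = μ * nhat := by rw [hμ]; ring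
    have h4 : (H.card : ℝ) / (3 * t) = μ * (2 * n / (5 * t)) - μ * n / (15 * t) := by
      rw [← hμn]
      field_simp
      norm_num
    have h5 : (n : ℝ) ^ (j + 1) ≤ μ * n / (15 * t) := by
      rw [le_div_iff₀ (by positivity), hpow]
      nlinarith
    rw [h3, h4]
    linarith
  · by_contra hno
    push Not at hno
    obtain ⟨P, hP, hd, hPc, hsub⟩ := D.exists_teams ht ha hH hn hL hm' (by
      intro S hS
      rcases le_or_gt nhat (body S (D.star S)).card with hle | hlt
      · have h1 := (hno S hS hle).le
        have h2 : ((body S (D.star S)).card : ℝ) ≤ n := by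
          rw [← hn]
          exact_mod_cast Finset.card_le_univ _
        have h3 : (nhat : ℝ) ≤ (body S (D.star S)).card := by exact_mod_cast hle
        have h4 : (H.card : ℝ) * nhat / n = μ * nhat := by rw [hμ]; ring
        have h5 := mul_le_mul_of_nonneg_left h3 hμ0.le
        have h6 := mul_le_mul_of_nonneg_left h2 (by positivity : 0 ≤ (n : ℝ) ^ j)
        rw [h4, hpow] at h1
        linarith
      · have h1 := D.card_star_le ht hH hS
        rcases Nat.eq_zero_or_pos (body S (D.star S)).card with h0 | hpos
        · rw [h0] at h1 ⊢
          simp only [Nat.choose_zero_succ, Nat.le_zero] at h1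
          simp [h1]
        · obtain ⟨b, hb⟩ : ∃ b, (body S (D.star S)).card = b + 1 := ⟨_, (Nat.succ_pred_eq_of_pos hpos).symm⟩
          rw [hb] at h1 hlt ⊢
          have h2 : ((b.choose (j + 1) : ℕ) : ℝ) < (j + 2) * (μ - (n : ℝ) ^ j) := by
            by_contra hge
            push Not at hge
            have := hleast.2 ⟨hpos, by rw [hset, hb]; exact hge⟩
            omega
          have h3 : ((b + 1 : ℕ) : ℝ) * (b.choose (j + 1) : ℝ) =
              ((b + 1).choose (j + 2) : ℝ) * (j + 2) := by
            have := Nat.add_one_mul_choose_eq b (j + 1)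
            exact_mod_cast this
          have h4 : ((D.star S).card : ℝ) ≤ ((b + 1).choose (j + 2) : ℝ) := by exact_mod_cast h1
          have h5 := mul_le_mul_of_nonneg_left h2.le (by positivity : (0 : ℝ) ≤ ((b + 1 : ℕ) : ℝ))
          rw [h3] at h5
          have h6 : ((b + 1).choose (j + 2) : ℝ) ≤ ((b + 1 : ℕ) : ℝ) * (μ - (n : ℝ) ^ j) := by
            refine le_of_mul_le_mul_right ?_ (by positivity : (0 : ℝ) < j + 2)
            linarith
          exact h4.trans h6)
    have h1 : H.card ≤ (n / t).choose (j + 2) := by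
      rw [← hPc, ← Finset.card_powersetCard]
      have h2 := Finset.card_le_card (subset_image_powersetCard (by omega) hH hP hd)
      rw [Finset.filter_true_of_mem hsub] at h2
      exact h2.trans Finset.card_image_le
    omega

/-! ### Bounded degree, and the theorem -/

/-- A star with few edges in comparison with `m / t` has few edges in comparison with its body. -/
theorem star_le_of_degree {t j a n b E : ℕ} {m : ℝ} (ht : 1 ≤ t) (htl : t ≤ j + 2)
    (hL : IsLarge t j a n)
    (hm : ((n / t).choose (j + 2) : ℝ) -
      (n : ℝ) ^ (j + 1) / (2 * (t : ℝ) ^ (j + 1) * ((j + 1).factorial : ℝ)) ≤ m)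
    (hE : E ≤ b.choose (j + 2)) (hEm : (E : ℝ) ≤ m / (3 * t)) :
    (E : ℝ) ≤ b * (m / n - (n : ℝ) ^ j) := by
  have htpos : (0 : ℝ) < t := by exact_mod_cast ht
  have ht1 : (1 : ℝ) ≤ t := by exact_mod_cast ht
  have hn0 : (0 : ℝ) < n := by exact_mod_cast hL.one_le
  have hlin : t * (j + 2) ≤ n := by have := hL.linear; linarith
  have hedge : (15 * t : ℝ) * (n : ℝ) ^ j < m / n := by
    have h1 := hL.average_gt (c := 15 * t) ht hm hL.edges
    push_cast at h1
    exact h1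
  have hav := average_lower ht hlin hm
  set μ : ℝ := m / n with hμ
  have hμn : μ * n = m := by rw [hμ]; field_simp
  have hN : 0 < (n : ℝ) ^ j := by positivity
  -- For large `b`, the bound `m / (3 * t)` suffices as `1 / 3 < 2 / 5` leaves room for the error `n
  -- ^ j`. For small `b`, `b.choose l` is already small: `t ≤ 2 ^ (j + 1)` gives `t * (2 / 5) ^ (j +
  -- 1) ≤ 4 / 5`.
  rcases le_or_gt (2 * n / (5 * t) : ℝ) b with hb | hb
  · have h1 : 0 ≤ μ - (n : ℝ) ^ j := by nlinarith
    refine hEm.trans (le_trans ?_ (mul_le_mul_of_nonneg_right hb h1))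
    have h0 : m / (3 * t) = μ * n / (3 * t) := by rw [hμn]
    rw [h0, div_mul_eq_mul_div (2 * (n : ℝ)), div_le_div_iff₀ (by positivity) (by positivity)]
    have h2 : 15 * (n : ℝ) ^ j ≤ μ := by nlinarith
    have h3 : 0 < (t : ℝ) * n := by positivity
    have h4 := mul_le_mul_of_nonneg_left h2 h3.le
    have h5 := mul_pos h3 hN
    linarith
  · have h1 : (E : ℝ) ≤ (b.choose (j + 2) : ℝ) := by exact_mod_cast hE
    refine h1.trans ((choose_le_mul_pow_div b j).trans ?_)
    refine mul_le_mul_of_nonneg_left ?_ (by positivity)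
    set A : ℝ := (t : ℝ) ^ (j + 2) * ((j + 2).factorial : ℝ) with hA
    have hApos : 0 < A := by positivity
    have h2 : (b : ℝ) ^ (j + 1) ≤ (2 * n / (5 * t)) ^ (j + 1) :=
      pow_le_pow_left₀ (by positivity) hb.le _
    have h3 : (t : ℝ) * (2 / 5) ^ (j + 1) ≤ 4 / 5 := by
      have h4 : (t : ℝ) ≤ 2 ^ (j + 1) := by
        exact_mod_cast htl.trans (Nat.lt_two_pow_self (n := j + 1))
      calc (t : ℝ) * (2 / 5) ^ (j + 1) ≤ 2 ^ (j + 1) * (2 / 5) ^ (j + 1) :=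
            mul_le_mul_of_nonneg_right h4 (by positivity)
        _ = (4 / 5) ^ (j + 1) := by rw [← mul_pow]; norm_num
        _ ≤ 4 / 5 := pow_le_of_le_one (by norm_num) (by norm_num) (by omega)
    have h4 : (2 * n / (5 * t) : ℝ) ^ (j + 1) / ((j + 2).factorial : ℝ) =
        ((t : ℝ) * (2 / 5) ^ (j + 1)) * ((n : ℝ) ^ j * (n / A)) := by
      have : (2 * n / (5 * t) : ℝ) = 2 / 5 * n / t := by field_simp
      rw [this, hA, div_pow, mul_pow]
      field_simp
      ring
    have h5 : ((t : ℝ) * (2 / 5) ^ (j + 1)) * ((n : ℝ) ^ j * (n / A)) ≤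
        4 / 5 * ((n : ℝ) ^ j * (n / A)) := mul_le_mul_of_nonneg_right h3 (by positivity)
    have h6 : 5 * ((j + 2 : ℝ) ^ 2 + 2) ≤ n / A := by
      rw [le_div_iff₀ hApos]
      have h7 : 5 * A * ((j + 2 : ℝ) ^ 2 + 2) ≤ n := by
        rw [hA]
        exact_mod_cast hL.body
      linarith
    have h7 := mul_le_mul_of_nonneg_left h6 hN.le
    calc (b : ℝ) ^ (j + 1) / ((j + 2).factorial : ℝ)
        ≤ 4 / 5 * ((n : ℝ) ^ j * (n / A)) := by
          refine le_trans (div_le_div_of_nonneg_right h2 (by positivity)) ?_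
          rw [h4]; exact h5
      _ ≤ μ - (n : ℝ) ^ j := by linarith

/-- Centres are nonempty, so each star has at most `maxDegree H` edges and `star_le_of_degree`
applies to all of them. -/
theorem subset_thickClique_of_degree [Fintype V] {t j a n : ℕ} {H : Finset (Finset V)}
    (D : Decomposition t (j + 2) a H) (ht : 2 ≤ t) (ha : 1 ≤ a) (htl : t ≤ j + 2)
    (hH : ∀ e ∈ H, e.card = (j + 2) * t) (hn : Fintype.card V = n) (hL : IsLarge t j a n)
    (hm : ((n / t).choose (j + 2) : ℝ) -
      (n : ℝ) ^ (j + 1) / (2 * (t : ℝ) ^ (j + 1) * ((j + 1).factorial : ℝ)) ≤ H.card)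
    (hdeg : (maxDegree H : ℝ) ≤ H.card / (3 * t)) :
    (∃ K : Finset (Finset V), IsThickClique ((j + 2) * t) t K ∧ H ⊆ K) ∧
      maxDegree H ≤ (n / t - 1).choose (j + 1) := by
  have ht0 : 0 < t := by omega
  obtain ⟨P, hP, hd, hPc, hsub⟩ := D.exists_teams (by omega) ha hH hn hL hm (by
    intro S hS
    refine star_le_of_degree (by omega) htl hL hm (D.card_star_le (by omega) hH hS)
      (le_trans ?_ hdeg)
    obtain ⟨v, hv⟩ : S.Nonempty := by
      rw [← Finset.card_pos, (D.isStar S hS).1]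
      exact Nat.mul_pos (by omega) (by omega)
    have h1 : (D.star S).card ≤ (H.filter fun e => v ∈ e).card :=
      Finset.card_le_card fun e he => Finset.mem_filter.mpr
        ⟨D.star_subset hS he, (D.isStar S hS).2 e he hv⟩
    have h2 : (H.filter fun e => v ∈ e).card ≤ maxDegree H :=
      Finset.le_sup (f := fun v : V => (H.filter fun e => v ∈ e).card) (Finset.mem_univ v)
    exact_mod_cast h1.trans h2)
  refine ⟨⟨(P.powersetCard (j + 2)).image fun Q => Q.biUnion id, ?_, ?_⟩, ?_⟩
  · exact ⟨P, by rw [hPc, hn], fun W hW => (hP W hW).1, hd, by rw [Nat.mul_div_cancel _ ht0]⟩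
  · have h2 := subset_image_powersetCard ht0 hH hP hd
    rwa [Finset.filter_true_of_mem hsub] at h2
  · refine Finset.sup_le fun v _ => ?_
    rw [← hPc]
    exact card_filter_mem_le ht0 hH hP hd hsub v

end StarsCliques

theorem theorem3p1 (r t : ℕ) (hr : 1 ≤ r) (ht : 2 ≤ t) :
    ∃ n₀ : ℕ, ∀ (V : Type*) [Fintype V] [DecidableEq V] (n m : ℕ) (H : Finset (Finset V)),
      Fintype.card V = n → n₀ ≤ n → H.card = m → StarsCliques.InJ r t H →
      (Nat.choose (n / t) (r * t) + 1 ≤ m →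
        StarsCliques.InF t (r * t) ((r * t ^ 2) ^ (r ^ 3 * t ^ 6)) H ∧
        ∃ nhat : ℕ,
          IsLeast {N : ℕ | 1 ≤ N ∧
            (r * t * m / n - r * t * n ^ (r * t - 2) : ℝ) ≤
              (Nat.choose (N - 1) (r * t - 1) : ℝ)} nhat ∧
          (n / (t : ℝ) ^ ((r * t : ℝ) / (r * t - 1)) - (3 * r * t : ℝ) ^ (3 * r * t) : ℝ)
            ≤ nhat ∧
          (2 * n / (5 * t) : ℝ) <
            n / (t : ℝ) ^ ((r * t : ℝ) / (r * t - 1)) - (3 * r * t : ℝ) ^ (3 * r * t) ∧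
          (m / (3 * t) : ℝ) < m * nhat / n - (n : ℝ) ^ (r * t - 1) ∧
          ∀ D : StarsCliques.Decomposition t (r * t) ((r * t ^ 2) ^ (r ^ 3 * t ^ 6)) H,
            ∃ S ∈ D.centres,
              nhat ≤ (StarsCliques.body S (D.star S)).card ∧
              (m * nhat / n - (n : ℝ) ^ (r * t - 1) : ℝ) ≤ (D.star S).card) ∧
      ((Nat.choose (n / t) (r * t) : ℝ) -
            (n : ℝ) ^ (r * t - 1) / (2 * (t : ℝ) ^ (r * t - 1) * (Nat.factorial (r * t - 1) : ℝ))
          ≤ (m : ℝ) →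
        m ≤ Nat.choose (n / t) (r * t) →
        (StarsCliques.maxDegree H : ℝ) ≤ m / (3 * t) →
        (∃ K : Finset (Finset V), StarsCliques.IsThickClique (r * t ^ 2) t K ∧ H ⊆ K) ∧
        StarsCliques.maxDegree H ≤ Nat.choose (n / t - 1) (r * t - 1)) := by
  -- As `r * t ≥ 2`, the natural subtractions `r * t - 1` and `r * t - 2` are genuine and become `j
  -- + 1` and `j`.
  obtain ⟨j, hj⟩ : ∃ j, r * t = j + 2 :=
    ⟨r * t - 2, by have := Nat.mul_le_mul hr ht; omega⟩
  have htl : t ≤ j + 2 := hj ▸ Nat.le_mul_of_pos_left t hr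
  have hjR : (r : ℝ) * t = j + 2 := by exact_mod_cast hj
  have ha : 1 ≤ (r * t ^ 2) ^ (r ^ 3 * t ^ 6) := Nat.one_le_pow _ _ (by positivity)
  obtain ⟨n₀, hn₀⟩ :=
    StarsCliques.exists_forall_isLarge t j ((r * t ^ 2) ^ (r ^ 3 * t ^ 6))
  refine ⟨n₀, fun V _ _ n m H hn hnn hm hJ => ?_⟩
  have hL := hn₀ n hnn
  have hF := hJ.inF hr ht
  subst hm
  have hk : r * t ^ 2 = (j + 2) * t := by rw [← hj]; ring
  have hH : ∀ e ∈ H, e.card = (j + 2) * t := fun e he => (hJ.1 e he).trans hk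
  have h1 : r * t - 1 = j + 1 := by omega
  have h2 : r * t - 2 = j := by omega
  have h3 : (j + 2 : ℝ) - 1 = j + 1 := by ring
  have h4 : 3 * r * t = 3 * (j + 2) := by rw [mul_assoc, hj]
  have h5 : (3 * r * t : ℝ) = 3 * (j + 2) := by rw [mul_assoc, hjR]
  rw [h1, h2, h4, h5, hjR, h3]
  refine ⟨fun hm => ⟨hF, ?_⟩, fun hm _ hdeg => ?_⟩
  · generalize (r * t ^ 2) ^ (r ^ 3 * t ^ 6) = a at *
    rw [hj] at hm ⊢
    exact StarsCliques.exists_large_star (by omega) ha htl hH hn hL hm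
  · obtain ⟨D⟩ := hF.2
    rw [hk]
    generalize (r * t ^ 2) ^ (r ^ 3 * t ^ 6) = a at *
    rw [hj] at hm D
    exact StarsCliques.subset_thickClique_of_degree D ht ha htl hH hn hL hm hdeg
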